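/- **Problem.** Let $T,m,n_t,r_t$ be integers and consider $$\min \sum_{t=1}^T f_t(x_t)\quad\text{s.t. } x_t\in X_t=\{x_t\in\mathbb R^{n_t}: c_t(x_t)=0\}\ (t\in[T]),\qquad Ax:=\sum_{t=1}^T A_tx_t=b, \tag{1}$$ where $f_t:\mathbb R^{n_t}\to\mathbb R$ and $c_t:\mathbb R^{n_t}\to\mathbb R^{r_t}$ are $C^2$, $A_t\in\mathbb R^{m\times n_t}$, every $X_t$ is non-empty and compact, $A=[A_1\cdots A_T]$ has full row rank, and (1) is feasible. Put $X=X_1\times\dots\times X_T$, $J(x)w=\big((\nabla c_t(x_t)^\top w_t)_t,\,Aw\big)$ and $\Lambda(x,\mu,\lambda)=\sum_t[f_t(x_t)+\mu_t^\top c_t(x_t)]+\lambda^\top(Ax-b)$. **Local solution.** Let $\epsilon\in(0,1)$ and $\theta=\epsilon^{-2}$. Let $(x^*,z^*)$ be a local solution of the penalty problem $\min\{\sum_t f_t(x_t)+\frac\theta2\|z\|^2: x\in X,\ Ax+z=b\}$ such that $J(x^*)$ has full row rank (LICQ), and let $\mu^*,\lambda^*$ be Lagrange multipliers, i.e. $\nabla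 f_t(x_t^*)+\nabla c_t(x_t^*)\mu_t^*+A_t^\top\lambda^*=0$ for all $t$ and $\theta z^*+\lambda^*=0$, such that the second-order sufficient condition holds: $w_x^\top\nabla^2_{xx}\Lambda(x^*,\mu^*,\lambda^*)w_x+\theta\|w_z\|^2>0$ for all $(w_x,w_z)\neq0$ with $\nabla c_t(x_t^*)^\top (w_x)_t=0$ for all $t$ and $Aw_x+w_z=0$. **Algorithm.** Given $x^0\in X$, $z^0,\lambda^0\in\mathbb R^m$ and $\rho,\tau_x,\tau_z>0$, for $k\ge1$: for each $t$, $x_t^k$ is a local minimizer over $y\in X_t$ of $$f_t(y)+(\lambda^{k-1})^\top A_ty+\tfrac\rho2\Big\|A_ty+\sum_{s\ne t}A_sx_s^{k-1}+z^{k-1}-b\Big\|^2+\tfrac{\tau_x}2\|A_t(y-x_t^{k-1})\|^2;$$ then $z^k=\dfrac{\tau_zz^{k-1}-\rho(Ax^k-b)-\lambda^{k-1}}{\tau_z+\rho+\theta}$ and $\lambda^k=\lambda^{k-1}+\rho(Ax^k+z^k-b)$. Assume that for all $k\ge1$ and all $t$ the Jacobian $\nabla c_t(x_t^k)^\top$ has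 full row rank, and that $x_t^k$ is, among all local minimizers of its subproblem, one closest to $x_t^{k-1}$ if $A_t$ has full column rank, and closest to $x_t^*$ otherwise. **Notation.** Let $D=\mathrm{diag}(A_1,\dots,A_T)$, $\Delta z^k=z^k-z^{k-1}$ for $k\ge1$, $\Delta z^0=-\tau_z^{-1}(\lambda^0+\theta z^0)$, and let $e_k\ge 0$ be defined by $$e_k^2=(\rho+\tau_x)\sum_t\|A_t(x_t^k-x_t^*)\|^2-\rho\|A(x^k-x^*)\|^2+(\rho+\tau_z)\|z^k-z^*\|^2+\tfrac1\rho\|\lambda^k-\lambda^*\|^2+\tau_z\|\Delta z^k\|^2 .$$ Let $\pi(x)=\|Ax-b\|$ and $\delta_t(x_t,\lambda)=\mathrm{dist}(\nabla f_t(x_t)+A_t^\top\lambda,\,-N_{X_t}(x_t))$, with $N_{X_t}$ the general (limiting) normal cone. Let $\hat\Phi=\min_{x\in X}\sum_tf_t(x_t)$ and $$\begin{aligned}\Phi^1={}&\sum_tf_t(x_t^1)+\tfrac\theta2\|z^1\|^2+(\lambda^1)^\top(Ax^1+z^1-b)+\tfrac\rho2\|Ax^1+z^1-b\|^2\\&+\tfrac{\tau_z}4\|z^1-z^0\|^2+\tfrac{\tau_x}4\sum_t\|A_t(x_t^1-x_t^0)\|^2.\end{aligned}$$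 **Theorem (local convergence).** There is $\bar\rho>0$ such that for all $\rho>\bar\rho$ and all $\tau_x,\tau_z>0$ with $$\frac{\tau_x}4-\frac{(T-1)\rho}2>0,\qquad \frac{\tau_z}4-\frac{2(\theta+\tau_z)^2}\rho>0,$$ there are $\epsilon',C>0$ such that every sequence generated as above from an initial point with $\|(Dx^0,z^0,\lambda^0)-(Dx^*,z^*,\lambda^*)\|<\epsilon'$ and $\lambda^0=-\theta z^0$ satisfies: 1. $x^k\to x^*$, $z^k\to z^*$, $\lambda^k\to\lambda^*$, at (at least) a sublinear rate: $e_k\to0$, $e_{k}\le e_{k-1}$ and $\|x^{k}-x^*\|\le C\,e_{k-1}$ for all $k\ge1$; 2. $x^*$ is an $\epsilon$-approximate KKT point of (1): $x^*\in X$ and $\max\{\pi(x^*),\max_t\delta_t(x_t^*,\lambda^*)\}\le\epsilon\sqrt{2(\Phi^1-\hat\Phi)}$; 3. $x^*$ satisfies the second-order sufficient condition for (1): $w^\top\nabla^2_{xx}\Lambda(x^*,\mu^*,\lambda^*)w>0$ for all $w\ne0$ with $J(x^*)w=0$. -/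

import Mathlib

open Filter Topology
open scoped InnerProductSpace

noncomputable section

/-- Euclidean space of column vectors with `k` entries. -/
abbrev Euc (k : ℕ) : Type := EuclideanSpace ℝ (Fin k)

/-- The space of block vectors `x = (x_1, …, x_T)`, `x_t ∈ ℝ^{n_t}`. -/
abbrev Blocks {T : ℕ} (n : Fin T → ℕ) : Type := (t : Fin T) → Euc (n t)

/-- The Euclidean norm of a block vector. -/
def blockNorm {T : ℕ} {n : Fin T → ℕ} (x : Blocks n) : ℝ :=
  Real.sqrt (∑ t, ‖x t‖ ^ 2)

/-- The regular (Fréchet) normals to `S` at `x ∈ S`: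
`⟨v, y - x⟩ ≤ o(‖y - x‖)` for `y ∈ S`. -/
def regularNormalCone {k : ℕ} (S : Set (Euc k)) (x : Euc k) : Set (Euc k) :=
  {v | x ∈ S ∧ ∀ e : ℝ, 0 < e → ∀ᶠ y in 𝓝[S] x, ⟪v, y - x⟫_ℝ ≤ e * ‖y - x‖}

/-- The general (limiting) normal cone to `S` at `x`: limits of regular normals taken at
points of `S` that converge to `x`. -/
def normalCone {k : ℕ} (S : Set (Euc k)) (x : Euc k) : Set (Euc k) :=
  {v | ∃ (u : ℕ → Euc k) (w : ℕ → Euc k), (∀ i, u i ∈ S) ∧ Tendsto u atTop (𝓝 x) ∧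
    (∀ i, w i ∈ regularNormalCone S (u i)) ∧ Tendsto w atTop (𝓝 v)}

/-- `y` is a local minimizer of `g` over `S`. -/
def IsLocalMinimizer {E : Type*} [TopologicalSpace E] (g : E → ℝ) (S : Set E) (y : E) : Prop :=
  y ∈ S ∧ IsLocalMinOn g S y

/-- `y` is a local minimizer of `g` over `S` that is closest to the point `q`. -/
def IsClosestLocalMinimizer {k : ℕ} (g : Euc k → ℝ) (S : Set (Euc k)) (q y : Euc k) : Prop :=
  IsLocalMinimizer g S y ∧ ∀ y', IsLocalMinimizer g S y' → ‖y - q‖ ≤ ‖y' - q‖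

/-- The quadratic form `wᵀ ∇²F(x) w` of the Hessian of `F` at `x`. -/
def hessianForm {T : ℕ} {n : Fin T → ℕ} (F : Blocks n → ℝ) (x w : Blocks n) : ℝ :=
  fderiv ℝ (fun y => fderiv ℝ F y) x w w

/-- The data of the problem: minimize `∑ t, f_t(x_t)` subject to `c_t(x_t) = 0` for all `t`
and `∑ t, A_t x_t = b`. The matrices `A_t` are given as linear maps. -/
structure BlockNLP (T m : ℕ) (n r : Fin T → ℕ) where
  f : (t : Fin T) → Euc (n t) → ℝ
  c : (t : Fin T) → Euc (n t) → Euc (r t)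
  A : (t : Fin T) → Euc (n t) →L[ℝ] Euc m
  b : Euc m

namespace BlockNLP

variable {T m : ℕ} {n r : Fin T → ℕ} (P : BlockNLP T m n r)

/-- `X_t = {x_t : c_t(x_t) = 0}`. -/
def X (t : Fin T) : Set (Euc (n t)) := {y | P.c t y = 0}

/-- `A x = ∑ t, A_t x_t`. -/
def couple (x : Blocks n) : Euc m := ∑ t, P.A t (x t)

/-- `∑ t, f_t(x_t)`. -/
def cost (x : Blocks n) : ℝ := ∑ t, P.f t (x t)

/-- The standing assumptions: non-empty compact `X_t`, twice continuously differentiable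
`f_t` and `c_t`, full row rank of `A = [A_1 … A_T]`, and feasibility. -/
structure Standing : Prop where
  nonempty_compact : ∀ t, (P.X t).Nonempty ∧ IsCompact (P.X t)
  smooth_f : ∀ t, ContDiff ℝ 2 (P.f t)
  full_row_rank : Function.Surjective P.couple
  feasible : ∃ x : Blocks n, (∀ t, x t ∈ P.X t) ∧ P.couple x = P.b
  smooth_c : ∀ t, ContDiff ℝ 2 (P.c t)

/-- The constraint Jacobian `J(x) w = (∇c(x)ᵀ w, A w)`. -/
def jacobian (x w : Blocks n) : Blocks r × Euc m :=
  (fun t => fderiv ℝ (P.c t) (x t) (w t), P.couple w)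

/-- The Lagrangian `Λ(x, μ, λ)` of the original problem. -/
def lagrangian (x : Blocks n) (mu : Blocks r) (lam : Euc m) : ℝ :=
  ∑ t, (P.f t (x t) + ⟪mu t, P.c t (x t)⟫_ℝ) + ⟪lam, P.couple x - P.b⟫_ℝ

/-- The Lagrangian `Λ_θ(x, z, μ, λ)` of the quadratic-penalty problem. -/
def penaltyLagrangian (θ : ℝ) (x : Blocks n) (z : Euc m) (mu : Blocks r) (lam : Euc m) : ℝ :=
  P.lagrangian x mu lam + θ / 2 * ‖z‖ ^ 2 + ⟪lam, z⟫_ℝ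

/-- The feasible set of the quadratic-penalty problem. -/
def penaltyFeasible : Set (Blocks n × Euc m) :=
  {p | (∀ t, p.1 t ∈ P.X t) ∧ P.couple p.1 + p.2 = P.b}

/-- The objective of the quadratic-penalty problem. -/
def penaltyCost (θ : ℝ) (p : Blocks n × Euc m) : ℝ := P.cost p.1 + θ / 2 * ‖p.2‖ ^ 2

/-- `(x, z)` is a local solution of the quadratic-penalty problem at which the constraint
Jacobian of the original problem has full row rank, and at which the second-order sufficient
conditions hold with Lagrange multipliers `(μ, λ)`. -/
structure IsRegularPenaltySolution (θ : ℝ) (x : Blocks n) (z : Euc m) (mu : Blocks r)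
    (lam : Euc m) : Prop where
  local_solution : IsLocalMinimizer (P.penaltyCost θ) P.penaltyFeasible (x, z)
  licq : Function.Surjective (P.jacobian x)
  stationary_x : ∀ t, gradient (P.f t) (x t)
      + ContinuousLinearMap.adjoint (fderiv ℝ (P.c t) (x t)) (mu t)
      + ContinuousLinearMap.adjoint (P.A t) lam = 0
  stationary_z : θ • z + lam = 0
  second_order : ∀ (wx : Blocks n) (wz : Euc m),
      (∀ t, fderiv ℝ (P.c t) (x t) (wx t) = 0) → P.couple wx + wz = 0 →
      0 < blockNorm wx + ‖wz‖ →
      0 < hessianForm (fun y => P.penaltyLagrangian θ y z mu lam) x wx + θ * ⟪wz, wz⟫_ℝ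

/-- The primal residual `π(x) = ‖A x - b‖`. -/
def primalResidual (x : Blocks n) : ℝ := ‖P.couple x - P.b‖

/-- The dual residual `δ_t(x_t, λ) = dist(∇f_t(x_t) + A_tᵀ λ, -N_{X_t}(x_t))`. -/
def dualResidual (t : Fin T) (y : Euc (n t)) (lam : Euc m) : ℝ :=
  Metric.infDist (gradient (P.f t) y + ContinuousLinearMap.adjoint (P.A t) lam)
    {v | -v ∈ normalCone (P.X t) y}

/-- The augmented Lagrangian of the quadratic-penalty problem. -/
def augLagrangian (ρ θ : ℝ) (x : Blocks n) (z lam : Euc m) : ℝ :=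
  P.cost x + θ / 2 * ‖z‖ ^ 2 + ⟪lam, P.couple x + z - P.b⟫_ℝ
    + ρ / 2 * ‖P.couple x + z - P.b‖ ^ 2

/-- The objective of the `t`-th block subproblem at the previous iterate `(x, z, λ)`.
Note that `‖v‖²` in the seminorm given by `A_tᵀ A_t` is `‖A_t v‖²`. -/
def subCost (ρ τx : ℝ) (x : Blocks n) (z lam : Euc m) (t : Fin T) (y : Euc (n t)) : ℝ :=
  P.f t y + ⟪lam, P.A t y⟫_ℝ
    + ρ / 2 * ‖P.A t y + ∑ s ∈ Finset.univ.erase t, P.A s (x s) + z - P.b‖ ^ 2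
    + τx / 2 * ‖P.A t (y - x t)‖ ^ 2

/-- `(x^k, z^k, λ^k)` is a sequence generated by the proximal Jacobi scheme. -/
structure IsIterates (ρ θ τx τz : ℝ) (x : ℕ → Blocks n) (z lam : ℕ → Euc m) : Prop where
  start : ∀ t, x 0 t ∈ P.X t
  x_update : ∀ k t,
    IsLocalMinimizer (P.subCost ρ τx (x k) (z k) (lam k) t) (P.X t) (x (k + 1) t)
  z_update : ∀ k, z (k + 1) =
    (τz + ρ + θ)⁻¹ • (τz • z k - ρ • (P.couple (x (k + 1)) - P.b) - lam k)
  lam_update : ∀ k, lam (k + 1) = lam k + ρ • (P.couple (x (k + 1)) + z (k + 1) - P.b)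

/-- The constraint Jacobians of all block subproblems have full row rank at the computed
solutions. -/
def SubproblemLICQ (x : ℕ → Blocks n) : Prop :=
  ∀ k t, Function.Surjective (fderiv ℝ (P.c t) (x (k + 1) t))

/-- Every computed subproblem solution is a local minimizer closest to the previous iterate if
`A_t` has full column rank, and closest to `xs t` otherwise. -/
def ClosestSelection (ρ τx : ℝ) (xs : Blocks n) (x : ℕ → Blocks n) (z lam : ℕ → Euc m) : Prop :=
  ∀ k t,
    (Function.Injective (P.A t) →
      IsClosestLocalMinimizer (P.subCost ρ τx (x k) (z k) (lam k) t) (P.X t)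
        (x k t) (x (k + 1) t)) ∧
    (¬ Function.Injective (P.A t) →
      IsClosestLocalMinimizer (P.subCost ρ τx (x k) (z k) (lam k) t) (P.X t)
        (xs t) (x (k + 1) t))

/-- The Lyapunov function `Φ(x, z, λ, x', z')`. -/
def lyapunov (ρ θ τx τz : ℝ) (x : Blocks n) (z lam : Euc m) (x' : Blocks n) (z' : Euc m) : ℝ :=
  P.augLagrangian ρ θ x z lam + τz / 4 * ‖z - z'‖ ^ 2
    + ∑ t, τx / 4 * ‖P.A t (x t - x' t)‖ ^ 2

/-- The minimum of `∑ t, f_t(x_t)` over `X_1 × … × X_T`. -/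
def minCost : ℝ := sInf (P.cost '' {x | ∀ t, x t ∈ P.X t})

/-- The Euclidean norm of `(D x, z, λ)`, where `D x = (A_1 x_1, …, A_T x_T)`. -/
def scaledNorm (x : Blocks n) (z lam : Euc m) : ℝ :=
  Real.sqrt (∑ t, ‖P.A t (x t)‖ ^ 2 + ‖z‖ ^ 2 + ‖lam‖ ^ 2)

/-- The weighted norm of `(D x, z, λ, δ)` in which convergence is measured, namely the square
root of `‖D x‖_R² + (ρ + τ_z) ‖z‖² + ‖λ‖² / ρ + τ_z ‖δ‖²`, where
`‖D x‖_R² = (ρ + τ_x) ∑ t, ‖A_t x_t‖² - ρ ‖A x‖²`. -/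
def rateNorm (ρ τx τz : ℝ) (x : Blocks n) (z lam δ : Euc m) : ℝ :=
  Real.sqrt (((ρ + τx) * ∑ t, ‖P.A t (x t)‖ ^ 2 - ρ * ‖P.couple x‖ ^ 2)
    + (ρ + τz) * ‖z‖ ^ 2 + 1 / ρ * ‖lam‖ ^ 2 + τz * ‖δ‖ ^ 2)

end BlockNLP

/-- `Δz^k = z^k - z^{k-1}` for `k ≥ 1`, and `Δz^0 = -(λ^0 + θ z^0) / τ_z`. -/
def deltaZ {m : ℕ} (θ τz : ℝ) (z lam : ℕ → Euc m) : ℕ → Euc m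
  | 0 => -(τz⁻¹ • (lam 0 + θ • z 0))
  | k + 1 => z (k + 1) - z k

/-- The errors `e` converge to zero at a (at least) Q-sublinear rate: all quotients of
successive errors are at most one. -/
def QSublinear (e : ℕ → ℝ) : Prop :=
  Tendsto e atTop (𝓝 0) ∧ (∀ k, 0 ≤ e k) ∧ ∀ k, e (k + 1) ≤ e k

end

/-! The second-order condition for the penalty problem, with `wz = -A w`, says that the block
Hessian of the Lagrangian plus `θ‖A w‖²` is positive on the kernel of the constraint Jacobians.
Compactness makes it positive definite once a multiple of `∑ ‖∇c_tᵀ w_t‖²` is added, and LICQ keeps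
multipliers at nearby stationary points close to `μ*`. Together these give quadratic growth, uniform
over base points near `x*` (`exists_growth`): the role of convexity is played by `f_t + ⟨ν_t, A_t
·⟩` augmented with `θ/2 ‖A ·‖²`.

Each block update is stationary for such a function, with the multiplier estimate `stepMultiplier`.
Growth at `x^{k+1}` towards `x*` and at `x*` towards `x^{k+1}`, added together, is a strong
monotonicity inequality. Inserted in the usual proximal ADMM computation (`energy_decrease`), it
shows that `e_k²` drops by at least `3σ‖x^{k+1} - x*‖² + 2θ‖Δz^{k+1}‖²`, provided `ρ` is large
enough to absorb the error `4θ²/ρ ‖A(x^{k+1} - x*)‖²`.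

The growth is only local, so the iterates must be kept near `x*`. The energy sees `x` only through
the `A_t x_t`; growth supplies some local minimizer of each subproblem near `x_t*`, and the
closest-minimizer rule then forces the computed one to be near as well (`exists_localization`).
Since the energy does not increase, an induction confines the whole sequence. The decrease is
summable, so `x^k → x*` and `Δz^k → 0`; the update relations carry this over to `z^k` and `λ^k`.

For the residual bound, the Lyapunov function decreases (`lyapunov_step`) to `∑ f_t(x_t*) + θ/2
‖z*‖²`, so `θ/2 ‖z*‖² ≤ Φ^1 - Φ̂`, where `‖z*‖ = π(x*)` and `θ = ε⁻²`. The dual residual is zero by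
stationarity, and the second-order condition for (1) is the case `wz = 0`. -/

/-! ### Taylor estimates uniform in the base point. -/

section Taylor

variable {E F : Type*} [NormedAddCommGroup E] [NormedSpace ℝ E]
  [NormedAddCommGroup F] [NormedSpace ℝ F]

/-- Uniform second order Taylor expansion near a point. -/
theorem exists_taylor_two {g : E → ℝ} (hg : ContDiff ℝ 2 g) (x : E) {ε : ℝ} (hε : 0 < ε) :
    ∃ r > 0, ∀ a ∈ Metric.ball x r, ∀ y ∈ Metric.ball x r,
      |g y - g a - fderiv ℝ g a (y - a) - 1 / 2 * fderiv ℝ (fderiv ℝ g) x (y - a) (y - a)|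
        ≤ ε * ‖y - a‖ ^ 2 := by
  set H := fderiv ℝ (fderiv ℝ g) x with hH
  have hsymm : ∀ v w, H v w = H w v := fun v w =>
    (hg.contDiffAt (x := x)).isSymmSndFDerivAt (by simp) v w
  have hg1 : ContDiff ℝ 1 (fderiv ℝ g) := hg.fderiv_right (by norm_num [one_add_one_eq_two])
  have hs : HasStrictFDerivAt (fderiv ℝ g) H x :=
    hg1.contDiffAt.hasStrictFDerivAt (by simp)
  have h1 := (hasStrictFDerivAt_iff_isLittleO.1 hs).def hε
  rw [nhds_prod_eq] at h1
  obtain ⟨s, hsx, hs'⟩ := (Filter.eventually_prod_self_iff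
    (r := fun p q => ‖fderiv ℝ g p - fderiv ℝ g q - H (p - q)‖ ≤ ε * ‖p - q‖)).1 h1
  obtain ⟨r, hr, hrs⟩ := Metric.mem_nhds_iff.1 hsx
  refine ⟨r, hr, fun a ha y hy => ?_⟩
  -- The Hessian stays frozen at `x`: after subtracting its quadratic form, strict differentiability
  -- of `fderiv ℝ g` at `x` makes the derivative nearly constant, and the mean value inequality
  -- applies. Symmetry of `H` merges the two terms of the product rule.
  have hdiff : ∀ u, HasFDerivAt (fun u => g u - 1 / 2 * H (u - a) (u - a))
      (fderiv ℝ g u - H (u - a)) u := by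
    intro u
    have e1 : HasFDerivAt g (fderiv ℝ g u) u :=
      (hg.differentiable (by simp) u).hasFDerivAt
    have e2 : HasFDerivAt (fun u => H (u - a)) H u :=
      H.hasFDerivAt.comp u ((hasFDerivAt_id u).sub_const a)
    have e3 := (e2.clm_apply ((hasFDerivAt_id u).sub_const a)).const_mul (1 / 2 : ℝ)
    refine (e1.sub e3).congr_fderiv ?_
    ext w
    have h3 : H.flip (u - a) w = H (u - a) w := hsymm w (u - a)
    simp only [sub_apply, smul_apply, add_apply, ContinuousLinearMap.comp_id, id_eq, h3,
      smul_eq_mul]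
    ring
  have key := Convex.norm_image_sub_le_of_norm_hasFDerivWithin_le'
    (f := fun u => g u - 1 / 2 * H (u - a) (u - a)) (s := segment ℝ a y) (x := a) (y := y)
    (f' := fun u => fderiv ℝ g u - H (u - a)) (φ := fderiv ℝ g a) (C := ε * ‖y - a‖)
    (fun u _ => (hdiff u).hasFDerivWithinAt) ?_ (convex_segment a y)
    (left_mem_segment ℝ a y) (right_mem_segment ℝ a y)
  · rw [Real.norm_eq_abs] at key
    refine le_trans (le_of_eq ?_) (key.trans (le_of_eq (by ring)))
    congr 1
    simp
    ring
  · intro u hu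
    have hub : u ∈ Metric.ball x r := (convex_ball x r).segment_subset ha hy hu
    have h2 := hs' u (hrs hub) a (hrs ha)
    have h3 : fderiv ℝ g u - H (u - a) - fderiv ℝ g a
      = fderiv ℝ g u - fderiv ℝ g a - H (u - a) := by abel
    rw [h3]
    refine h2.trans ?_
    gcongr
    simpa [norm_sub_rev] using norm_sub_le_of_mem_segment hu

/-- Near any point a `C²` map has Lipschitz derivative and quadratic linearization error. -/
theorem exists_linearization_bound {c : E → F} (hc : ContDiff ℝ 2 c) (x : E) :
    ∃ r > 0, ∃ K : ℝ, 0 ≤ K ∧ ∀ a ∈ Metric.ball x r, ∀ y ∈ Metric.ball x r,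
      ‖fderiv ℝ c y - fderiv ℝ c a‖ ≤ K * ‖y - a‖ ∧
      ‖c y - c a - fderiv ℝ c a (y - a)‖ ≤ K * ‖y - a‖ ^ 2 := by
  have hg1 : ContDiff ℝ 1 (fderiv ℝ c) := hc.fderiv_right (by norm_num [one_add_one_eq_two])
  obtain ⟨K, s, hsx, hs⟩ :=
    (hg1.contDiffAt.hasStrictFDerivAt (x := x) (by simp)).exists_lipschitzOnWith
  obtain ⟨r, hr, hrs⟩ := Metric.mem_nhds_iff.1 hsx
  have hlip : ∀ a ∈ Metric.ball x r, ∀ y ∈ Metric.ball x r,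
      ‖fderiv ℝ c y - fderiv ℝ c a‖ ≤ K * ‖y - a‖ := fun a ha y hy => by
    simpa [dist_eq_norm] using hs.dist_le_mul y (hrs hy) a (hrs ha)
  refine ⟨r, hr, K, K.2, fun a ha y hy => ⟨hlip a ha y hy, ?_⟩⟩
  have key := Convex.norm_image_sub_le_of_norm_hasFDerivWithin_le'
    (f := c) (s := segment ℝ a y) (x := a) (y := y)
    (f' := fun u => fderiv ℝ c u) (φ := fderiv ℝ c a) (C := K * ‖y - a‖)
    (fun u _ => (hc.differentiable (by simp) u).hasFDerivAt.hasFDerivWithinAt) ?_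
    (convex_segment a y) (left_mem_segment ℝ a y) (right_mem_segment ℝ a y)
  · exact key.trans (le_of_eq (by ring))
  · intro u hu
    have hub : u ∈ Metric.ball x r := (convex_ball x r).segment_subset ha hy hu
    refine (hlip a ha u hub).trans ?_
    gcongr
    simpa [norm_sub_rev] using norm_sub_le_of_mem_segment hu

end Taylor

/-! ### Positive definiteness by penalization. -/

/-- If `p ≥ 0` and `q` are continuous, homogeneous of degree two, and `q` is positive on the
nonzero zeros of `p`, then `q + K p` is positive definite for some `K`. -/
theorem exists_penalty_posDef {E : Type*} [NormedAddCommGroup E] [NormedSpace ℝ E]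
    [FiniteDimensional ℝ E] {q p : E → ℝ} (hq : Continuous q) (hp : Continuous p)
    (hq2 : ∀ (s : ℝ) w, q (s • w) = s ^ 2 * q w) (hp2 : ∀ (s : ℝ) w, p (s • w) = s ^ 2 * p w)
    (hp0 : ∀ w, 0 ≤ p w) (hpos : ∀ w, w ≠ 0 → p w = 0 → 0 < q w) :
    ∃ σ > 0, ∃ K : ℝ, 0 ≤ K ∧ ∀ w, σ * ‖w‖ ^ 2 ≤ q w + K * p w := by
  have hcomp : IsCompact (Metric.sphere (0 : E) 1) := isCompact_sphere 0 1
  -- The open sets `{q + N p > 0}` increase with `N` and cover the unit sphere, so by compactness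
  -- one of them contains it.
  obtain ⟨K, hK⟩ := hcomp.elim_directed_cover (fun N : ℕ => {w | 0 < q w + N * p w})
    (fun N => isOpen_lt continuous_const (by fun_prop)) (by
      intro w hw
      have hw0 : w ≠ 0 := by
        rintro rfl
        simp at hw
      rw [Set.mem_iUnion]
      rcases (hp0 w).eq_or_lt with h | h
      · exact ⟨0, by simpa [← h] using hpos w hw0 h.symm⟩
      · obtain ⟨N, hN⟩ := exists_nat_gt (-q w / p w)
        refine ⟨N, ?_⟩
        rw [div_lt_iff₀ h] at hN
        simp only [Set.mem_ofPred_eq]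
        linarith) (by
      refine (monotone_nat_of_le_succ fun N => ?_).directed_le
      intro w hw
      simp only [Set.mem_ofPred_eq] at hw ⊢
      push_cast
      linarith [hp0 w])
  have hcont : Continuous fun w => q w + K * p w := by fun_prop
  obtain ⟨σ, hσ, hmin⟩ : ∃ σ > 0, ∀ w ∈ Metric.sphere (0 : E) 1, σ ≤ q w + K * p w := by
    rcases (Metric.sphere (0 : E) 1).eq_empty_or_nonempty with h | h
    · exact ⟨1, one_pos, by simp [h]⟩
    · obtain ⟨w, hw, hmin⟩ := hcomp.exists_isMinOn h hcont.continuousOn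
      exact ⟨_, hK hw, fun v hv => hmin hv⟩
  refine ⟨σ, hσ, K, K.cast_nonneg, fun w => ?_⟩
  by_cases hw : w = 0
  · have h1 := hq2 0 0
    have h2 := hp2 0 0
    simp only [smul_zero] at h1 h2
    rw [hw, h1, h2]
    norm_num
  · have hn : 0 < ‖w‖ := norm_pos_iff.2 hw
    have h1 := hmin (‖w‖⁻¹ • w) (by simp [norm_smul, hn.ne'])
    rw [hq2, hp2] at h1
    have h2 := mul_le_mul_of_nonneg_left h1 (sq_nonneg ‖w‖)
    rw [mul_comm]
    refine h2.trans (le_of_eq ?_)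
    field_simp

/-! ### Stationary points of a single block. -/

section Block

variable {E F M : Type*} [NormedAddCommGroup E] [InnerProductSpace ℝ E]
  [NormedAddCommGroup F] [InnerProductSpace ℝ F]
  [NormedAddCommGroup M] [InnerProductSpace ℝ M]

/-- `a` is stationary for `f + ⟨ν, A ·⟩` on `{c = 0}`, with multiplier `μ`. -/
def IsKKTPoint (f : E → ℝ) (c : E → F) (A : E →L[ℝ] M) (a : E) (μ : F) (ν : M) : Prop :=
  ∀ w, fderiv ℝ f a w + ⟪μ, fderiv ℝ c a w⟫_ℝ + ⟪ν, A w⟫_ℝ = 0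

theorem fderiv_add_inner {f : E → ℝ} {c : E → F} {a : E} (hf : DifferentiableAt ℝ f a)
    (hc : DifferentiableAt ℝ c a) (μ : F) (w : E) :
    fderiv ℝ (fun y => f y + ⟪μ, c y⟫_ℝ) a w = fderiv ℝ f a w + ⟪μ, fderiv ℝ c a w⟫_ℝ := by
  have h : HasFDerivAt (fun y => f y + ⟪μ, c y⟫_ℝ)
      (fderiv ℝ f a + (innerSL ℝ μ).comp (fderiv ℝ c a)) a :=
    hf.hasFDerivAt.add ((innerSL ℝ μ).hasFDerivAt.comp a hc.hasFDerivAt)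
  rw [h.fderiv]
  simp

/-- Under LICQ, multipliers of nearby stationary points depend continuously on the data. -/
theorem IsKKTPoint.exists_multiplier_close [FiniteDimensional ℝ F] {f : E → ℝ} {c : E → F} {A : E →L[ℝ] M}
    {x : E} {μs : F} {νs : M} (hf : ContDiff ℝ 2 f) (hc : ContDiff ℝ 2 c)
    (hsurj : Function.Surjective (fderiv ℝ c x))
    (hx : IsKKTPoint f c A x μs νs) {δ : ℝ} (hδ : 0 < δ) :
    ∃ r > 0, ∃ η > 0, ∀ a ∈ Metric.ball x r, ∀ μ ν, ‖ν - νs‖ < η →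
      IsKKTPoint f c A a μ ν → ‖μ - μs‖ ≤ δ := by
  obtain ⟨R, hR⟩ := (fderiv ℝ c x).exists_rightInverse_of_surjective
    (LinearMap.range_eq_top.2 hsurj)
  set L : E → ℝ := fun y => f y + ⟪μs, c y⟫_ℝ with hL
  have hLs : ContDiff ℝ 2 L := hf.add (contDiff_const.inner ℝ hc)
  have hLc : Continuous (fderiv ℝ L) := hLs.continuous_fderiv (by simp)
  have hcc : Continuous (fderiv ℝ c) := hc.continuous_fderiv (by simp)
  -- The first bound lets the term quadratic in `h = μ - μs` be absorbed by `‖h‖²/2`; the second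
  -- makes each of the two linear terms at most `δ/4 ‖h‖`.
  set ζ : ℝ := min (1 / (2 * (‖R‖ + 1))) (δ / (4 * (‖R‖ + 1))) with hζ
  have hRp : 0 < ‖R‖ + 1 := by positivity
  have hζ0 : 0 < ζ := by positivity
  obtain ⟨r1, hr1, h1⟩ := Metric.continuousAt_iff.1 hLc.continuousAt ζ hζ0
  obtain ⟨r2, hr2, h2⟩ := Metric.continuousAt_iff.1 hcc.continuousAt ζ hζ0
  refine ⟨min r1 r2, lt_min hr1 hr2, ζ / (‖A‖ + 1), by positivity, ?_⟩
  intro a ha μ ν hν hst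
  have hd1 : ‖fderiv ℝ L a - fderiv ℝ L x‖ ≤ ζ := by
    rw [← dist_eq_norm]
    exact (h1 ((Metric.mem_ball.1 ha).trans_le (min_le_left _ _))).le
  have hd2 : ‖fderiv ℝ c a - fderiv ℝ c x‖ ≤ ζ := by
    rw [← dist_eq_norm]
    exact (h2 ((Metric.mem_ball.1 ha).trans_le (min_le_right _ _))).le
  set h := μ - μs with hh
  set w := R h with hw
  have hcw : fderiv ℝ c x w = h := by
    have := congrArg (fun T : F →L[ℝ] F => T h) hR
    simpa using this
  have e1 := hst w
  have e2 := hx w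
  have hLa : fderiv ℝ L a w = fderiv ℝ f a w + ⟪μs, fderiv ℝ c a w⟫_ℝ :=
    fderiv_add_inner (hf.differentiable (by simp) a) (hc.differentiable (by simp) a) μs w
  have hLx : fderiv ℝ L x w = fderiv ℝ f x w + ⟪μs, fderiv ℝ c x w⟫_ℝ :=
    fderiv_add_inner (hf.differentiable (by simp) x) (hc.differentiable (by simp) x) μs w
  -- The difference of the two stationarity identities, tested on `w = R h`, for which the left side
  -- is `‖h‖²`.
  have e3 : ⟪h, fderiv ℝ c x w⟫_ℝ = -((fderiv ℝ L a - fderiv ℝ L x) w) - ⟪ν - νs, A w⟫_ℝ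
      - ⟪h, (fderiv ℝ c a - fderiv ℝ c x) w⟫_ℝ := by
    simp only [sub_apply, hLa, hLx, inner_sub_left, inner_sub_right, hh]
    linarith
  rw [hcw, real_inner_self_eq_norm_sq] at e3
  have b0 : ‖w‖ ≤ (‖R‖ + 1) * ‖h‖ :=
    (R.le_opNorm h).trans (mul_le_mul_of_nonneg_right (by linarith) (norm_nonneg _))
  have b1 : -((fderiv ℝ L a - fderiv ℝ L x) w) ≤ ζ * ‖w‖ :=
    (neg_le_abs _).trans (((fderiv ℝ L a - fderiv ℝ L x).le_opNorm w).trans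
      (mul_le_mul_of_nonneg_right hd1 (norm_nonneg _)))
  have b2 : -⟪ν - νs, A w⟫_ℝ ≤ ζ * ‖w‖ := by
    refine (neg_le_abs _).trans ((abs_real_inner_le_norm _ _).trans ?_)
    calc ‖ν - νs‖ * ‖A w‖ ≤ ζ / (‖A‖ + 1) * ((‖A‖ + 1) * ‖w‖) := by
          gcongr
          exact (A.le_opNorm w).trans
            (mul_le_mul_of_nonneg_right (by linarith) (norm_nonneg _))
      _ = ζ * ‖w‖ := by
          have : 0 < ‖A‖ + 1 := by positivity
          field_simp
  have b3 : -⟪h, (fderiv ℝ c a - fderiv ℝ c x) w⟫_ℝ ≤ ‖h‖ * (ζ * ‖w‖) := by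
    refine (neg_le_abs _).trans ((abs_real_inner_le_norm _ _).trans ?_)
    gcongr
    exact ((fderiv ℝ c a - fderiv ℝ c x).le_opNorm w).trans
      (mul_le_mul_of_nonneg_right hd2 (norm_nonneg _))
  have hζ1 : ζ * (‖R‖ + 1) ≤ 1 / 2 := by
    have := min_le_left (1 / (2 * (‖R‖ + 1))) (δ / (4 * (‖R‖ + 1)))
    calc ζ * (‖R‖ + 1) ≤ 1 / (2 * (‖R‖ + 1)) * (‖R‖ + 1) := by gcongr
      _ = 1 / 2 := by field_simp
  have hζ2 : ζ * (‖R‖ + 1) ≤ δ / 4 := by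
    have := min_le_right (1 / (2 * (‖R‖ + 1))) (δ / (4 * (‖R‖ + 1)))
    calc ζ * (‖R‖ + 1) ≤ δ / (4 * (‖R‖ + 1)) * (‖R‖ + 1) := by gcongr
      _ = δ / 4 := by field_simp
  have hn := norm_nonneg h
  have b4 : ζ * ‖w‖ ≤ δ / 4 * ‖h‖ := by
    calc ζ * ‖w‖ ≤ ζ * ((‖R‖ + 1) * ‖h‖) := by gcongr
      _ = ζ * (‖R‖ + 1) * ‖h‖ := by ring
      _ ≤ _ := by gcongr
  have b5 : ‖h‖ * (ζ * ‖w‖) ≤ 1 / 2 * ‖h‖ ^ 2 := by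
    calc ‖h‖ * (ζ * ‖w‖) ≤ ‖h‖ * (ζ * ((‖R‖ + 1) * ‖h‖)) := by gcongr
      _ = ζ * (‖R‖ + 1) * ‖h‖ ^ 2 := by ring
      _ ≤ _ := by gcongr
  have b6 : ‖h‖ ^ 2 ≤ δ * ‖h‖ := by linarith
  rcases hn.eq_or_lt with h0 | h0
  · rw [← h0]; exact hδ.le
  · rw [sq] at b6
    exact le_of_mul_le_mul_right b6 h0

/-- Uniform second order lower bound at nearby stationary points of `f + ⟨ν, A ·⟩` on
`{c = 0}`. -/
theorem IsKKTPoint.exists_second_order_bound [FiniteDimensional ℝ F] {f : E → ℝ} {c : E → F} {A : E →L[ℝ] M}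
    {x : E} {μs : F} {νs : M} (hf : ContDiff ℝ 2 f) (hc : ContDiff ℝ 2 c)
    (hsurj : Function.Surjective (fderiv ℝ c x))
    (hx : IsKKTPoint f c A x μs νs) {κ : ℝ} (hκ : 0 < κ) :
    ∃ r > 0, ∃ η > 0, ∀ a ∈ Metric.ball x r, ∀ y ∈ Metric.ball x r, c a = 0 → c y = 0 →
      ∀ μ ν, ‖ν - νs‖ < η → IsKKTPoint f c A a μ ν →
        1 / 2 * fderiv ℝ (fderiv ℝ fun u => f u + ⟪μs, c u⟫_ℝ) x (y - a) (y - a)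
            - κ * ‖y - a‖ ^ 2 ≤ f y - f a + ⟪ν, A (y - a)⟫_ℝ ∧
        ‖fderiv ℝ c x (y - a)‖ ^ 2 ≤ κ * ‖y - a‖ ^ 2 := by
  have hLs : ContDiff ℝ 2 (fun u => f u + ⟪μs, c u⟫_ℝ) := hf.add (contDiff_const.inner ℝ hc)
  obtain ⟨r1, hr1, h1⟩ := exists_taylor_two hLs x (half_pos hκ)
  obtain ⟨r2, hr2, K, hK, h2⟩ := exists_linearization_bound hc x
  obtain ⟨r3, hr3, η, hη, h3⟩ := hx.exists_multiplier_close hf hc hsurj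
    (δ := κ / (2 * (K + 1))) (by positivity)
  -- With this radius `3 K r4 ≤ min 1 κ`, and `(min 1 κ)² ≤ κ`.
  set r4 : ℝ := min 1 κ / (3 * (K + 1)) with hr4
  have hr4p : 0 < r4 := by positivity
  refine ⟨min (min r1 r2) (min r3 r4), by positivity, η, hη, ?_⟩
  intro a ha y hy hca hcy μ ν hν hst
  simp only [Metric.mem_ball, lt_min_iff] at ha hy
  obtain ⟨⟨ha1, ha2⟩, ha3, ha4⟩ := ha
  obtain ⟨⟨hy1, hy2⟩, hy3, hy4⟩ := hy
  have t := h1 a ha1 y hy1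
  have l := (h2 a ha2 y hy2).2
  have l' := (h2 a ha2 x (by simpa using hr2)).1
  have m := h3 a ha3 μ ν hν hst
  rw [hca, hcy, sub_zero, zero_sub, norm_neg] at l
  simp only [hca, hcy, inner_zero_right, add_zero] at t
  rw [fderiv_add_inner (hf.differentiable (by simp) a) (hc.differentiable (by simp) a)] at t
  set d := y - a with hd
  have s := hst d
  constructor
  -- Stationarity at `a` holds with `μ`, whereas the Taylor expansion uses `μs`. The mismatch is
  -- harmless: `∇c(a)ᵀ d` is of second order in `d` because both points are feasible, and its factor
  -- `μ - μs` is small.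
  · have e : -⟪μ - μs, fderiv ℝ c a d⟫_ℝ ≥ -(κ / 2 * ‖d‖ ^ 2) := by
      have : ⟪μ - μs, fderiv ℝ c a d⟫_ℝ ≤ κ / (2 * (K + 1)) * (K * ‖d‖ ^ 2) :=
        (real_inner_le_norm _ _).trans (by gcongr)
      have h5 : κ / (2 * (K + 1)) * (K * ‖d‖ ^ 2) ≤ κ / (2 * (K + 1)) * ((K + 1) * ‖d‖ ^ 2) := by
        gcongr
        linarith
      have h6 : κ / (2 * (K + 1)) * ((K + 1) * ‖d‖ ^ 2) = κ / 2 * ‖d‖ ^ 2 := by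
        field_simp
      linarith
    rw [inner_sub_left] at e
    have t' := (abs_le.1 t).1
    linarith
  · have hax : ‖x - a‖ ≤ r4 := by rw [← dist_eq_norm, dist_comm]; exact ha4.le
    have hda : ‖d‖ ≤ 2 * r4 := by
      have : ‖d‖ ≤ dist y x + dist a x := by
        rw [hd, ← dist_eq_norm, dist_comm a x]; exact dist_triangle _ _ _
      linarith
    have e : fderiv ℝ c x d = (fderiv ℝ c x - fderiv ℝ c a) d + fderiv ℝ c a d := by simp
    have b : ‖fderiv ℝ c x d‖ ≤ min 1 κ * ‖d‖ := by
      rw [e]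
      have e1 : ‖(fderiv ℝ c x - fderiv ℝ c a) d‖ ≤ K * r4 * ‖d‖ :=
        ((fderiv ℝ c x - fderiv ℝ c a).le_opNorm d).trans
          (mul_le_mul_of_nonneg_right (l'.trans (by gcongr)) (norm_nonneg _))
      have e2 : ‖fderiv ℝ c a d‖ ≤ K * (2 * r4) * ‖d‖ := by
        refine l.trans ?_
        rw [sq, ← mul_assoc]
        gcongr
      have e3 : K * r4 + K * (2 * r4) ≤ min 1 κ := by
        have : 3 * (K + 1) * r4 = min 1 κ := by rw [hr4]; field_simp
        nlinarith
      refine (norm_add_le _ _).trans ?_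
      calc _ ≤ (K * r4 + K * (2 * r4)) * ‖d‖ := by linarith
        _ ≤ _ := by gcongr
    have hm : 0 ≤ min 1 κ := by positivity
    calc ‖fderiv ℝ c x d‖ ^ 2 ≤ (min 1 κ * ‖d‖) ^ 2 := by gcongr
      _ = (min 1 κ * min 1 κ) * ‖d‖ ^ 2 := by ring
      _ ≤ (1 * κ) * ‖d‖ ^ 2 := by
          gcongr
          · exact min_le_left _ _
          · exact min_le_right _ _
      _ = _ := by ring

/-- Existence of a multiplier at a local minimizer satisfying LICQ. -/
theorem exists_isKKTPoint [CompleteSpace E] [FiniteDimensional ℝ F] {f g : E → ℝ} {c : E → F} {A : E →L[ℝ] M} {a : E}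
    {ν : M} (hc : ContDiff ℝ 2 c) (hg : ContDiff ℝ 1 g)
    (hmin : IsLocalMinimizer g {y | c y = 0} a) (hsurj : Function.Surjective (fderiv ℝ c a))
    (hν : ∀ w, fderiv ℝ g a w = fderiv ℝ f a w + ⟪ν, A w⟫_ℝ) :
    ∃ μ, IsKKTPoint f c A a μ ν := by
  have hca : c a = 0 := hmin.1
  obtain ⟨Λ, Λ₀, hne, h⟩ := IsLocalExtrOn.exists_linear_map_of_hasStrictFDerivAt
    (f := c) (φ := g) (x₀ := a) (by rw [hca]; exact Or.inl hmin.2)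
    (hc.contDiffAt.hasStrictFDerivAt (by simp)) (hg.contDiffAt.hasStrictFDerivAt (by simp))
  -- The Fritz John multiplier of the objective cannot vanish: surjectivity of the Jacobian would
  -- make the other multiplier vanish too.
  have h0 : Λ₀ ≠ 0 := by
    rintro rfl
    apply hne
    have : Λ = 0 := by
      ext v
      obtain ⟨w, rfl⟩ := hsurj v
      simpa using h w
    simp [this]
  refine ⟨Λ₀⁻¹ • (InnerProductSpace.toDual ℝ F).symm (LinearMap.toContinuousLinearMap Λ),
    fun w => ?_⟩
  have := h w
  rw [hν] at this
  rw [real_inner_smul_left, InnerProductSpace.toDual_symm_apply]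
  simp only [LinearMap.coe_toContinuousLinearMap', smul_eq_mul] at this ⊢
  field_simp
  linarith

end Block

/-! ### The Hessian of the separable Lagrangian. -/

section Hessian

variable {T m : ℕ} {n r : Fin T → ℕ} (P : BlockNLP T m n r)

/-- The coupling constraint enters the Lagrangian linearly, so the Hessian is block diagonal and the
second-order condition can be combined with blockwise Taylor estimates. -/
theorem hessianForm_sum_add_linear {F : Blocks n → ℝ} {g : (t : Fin T) → Euc (n t) → ℝ}
    (hg : ∀ t, ContDiff ℝ 2 (g t)) (ℓ : Blocks n →L[ℝ] ℝ) (k : ℝ)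
    (hF : ∀ y, F y = ∑ t, g t (y t) + ℓ y + k) (x w : Blocks n) :
    hessianForm F x w = ∑ t, fderiv ℝ (fderiv ℝ (g t)) (x t) (w t) (w t) := by
  have h1 : ∀ y, fderiv ℝ F y = ∑ t, (fderiv ℝ (g t) (y t)).comp
      (ContinuousLinearMap.proj (R := ℝ) (φ := fun t => Euc (n t)) t) + ℓ := by
    intro y
    have : HasFDerivAt F (∑ t, (fderiv ℝ (g t) (y t)).comp
      (ContinuousLinearMap.proj (R := ℝ) (φ := fun t => Euc (n t)) t) + ℓ) y := by
      rw [show F = fun y => ∑ t, g t (y t) + ℓ y + k from funext hF]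
      refine (HasFDerivAt.add (HasFDerivAt.fun_sum fun t _ => ?_) ℓ.hasFDerivAt).add_const k
      exact (((hg t).differentiable (by simp) (y t)).hasFDerivAt).comp y
        (ContinuousLinearMap.proj (R := ℝ) (φ := fun t => Euc (n t)) t).hasFDerivAt
    exact this.fderiv
  unfold hessianForm
  have h2 : HasFDerivAt (fun y => fderiv ℝ F y w)
      (∑ t, ((fderiv ℝ (fderiv ℝ (g t)) (x t)).flip (w t)).comp
        (ContinuousLinearMap.proj (R := ℝ) (φ := fun t => Euc (n t)) t)) x := by
    have e : (fun y => fderiv ℝ F y w) = fun y => ∑ t, fderiv ℝ (g t) (y t) (w t) + ℓ w := by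
      funext y
      simp [h1]
    rw [e]
    refine (HasFDerivAt.fun_sum fun t _ => ?_).add_const _
    have h3 : HasFDerivAt (fderiv ℝ (g t)) (fderiv ℝ (fderiv ℝ (g t)) (x t)) (x t) :=
      ((((hg t).fderiv_right (m := 1) (by norm_num [one_add_one_eq_two])).differentiable
        (by simp)) (x t)).hasFDerivAt
    have h4 : HasFDerivAt (fun v => fderiv ℝ (g t) v (w t))
        ((fderiv ℝ (fderiv ℝ (g t)) (x t)).flip (w t)) (x t) := by
      refine (h3.clm_apply (hasFDerivAt_const (w t) (x t))).congr_fderiv ?_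
      ext v
      simp
    exact h4.comp x (ContinuousLinearMap.proj (R := ℝ) (φ := fun t => Euc (n t)) t).hasFDerivAt
  have h5 : DifferentiableAt ℝ (fun y => fderiv ℝ F y) x := by
    rw [show (fun y => fderiv ℝ F y) = _ from funext h1]
    refine DifferentiableAt.add_const _ (DifferentiableAt.fun_sum fun t _ => ?_)
    refine DifferentiableAt.clm_comp ?_ (differentiableAt_const _)
    exact DifferentiableAt.comp x (f := fun y : Blocks n => y t)
      (((hg t).fderiv_right (m := 1) (by norm_num [one_add_one_eq_two])).differentiable
        (by simp) _) (by fun_prop)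
  have h6 : fderiv ℝ (fun y => fderiv ℝ F y w) x w
      = fderiv ℝ (fun y => fderiv ℝ F y) x w w := by
    rw [fderiv_clm_apply h5 (differentiableAt_const w)]
    simp
  rw [← h6, h2.fderiv]
  simp

namespace BlockNLP

/-- `A` as a continuous linear map on block vectors. -/
noncomputable def coupleL : Blocks n →L[ℝ] Euc m :=
  ∑ t, (P.A t).comp (ContinuousLinearMap.proj (R := ℝ) (φ := fun t => Euc (n t)) t)

theorem coupleL_apply (x : Blocks n) : P.coupleL x = P.couple x := by
  simp [coupleL, couple]

theorem couple_sub (x y : Blocks n) : P.couple (x - y) = P.couple x - P.couple y := by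
  simp only [← coupleL_apply, map_sub]

/-- The second derivative of the Lagrangian of block `t` at `x_t`. -/
noncomputable def blockHessian (x : Blocks n) (mu : Blocks r) (t : Fin T) :
    Euc (n t) →L[ℝ] Euc (n t) →L[ℝ] ℝ :=
  fderiv ℝ (fderiv ℝ fun u => P.f t u + ⟪mu t, P.c t u⟫_ℝ) (x t)

variable {P}

theorem Standing.contDiff_blockLagrangian (hP : P.Standing) (mu : Blocks r) (t : Fin T) :
    ContDiff ℝ 2 fun u => P.f t u + ⟪mu t, P.c t u⟫_ℝ :=
  (hP.smooth_f t).add (contDiff_const.inner ℝ (hP.smooth_c t))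

theorem Standing.hessianForm_lagrangian (hP : P.Standing) (x w : Blocks n) (mu : Blocks r)
    (lam : Euc m) :
    hessianForm (fun y => P.lagrangian y mu lam) x w
      = ∑ t, P.blockHessian x mu t (w t) (w t) := by
  refine hessianForm_sum_add_linear (hP.contDiff_blockLagrangian mu)
    ((innerSL ℝ lam).comp P.coupleL) (-⟪lam, P.b⟫_ℝ) (fun y => ?_) x w
  simp [lagrangian, coupleL_apply, inner_sub_right]
  ring

theorem hessianForm_penaltyLagrangian (θ : ℝ) (x w : Blocks n) (z : Euc m) (mu : Blocks r)
    (lam : Euc m) :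
    hessianForm (fun y => P.penaltyLagrangian θ y z mu lam) x w
      = hessianForm (fun y => P.lagrangian y mu lam) x w := by
  have : (fun y => fderiv ℝ (fun y => P.penaltyLagrangian θ y z mu lam) y)
      = fun y => fderiv ℝ (fun y => P.lagrangian y mu lam) y := by
    funext y
    simp [penaltyLagrangian, add_assoc]
  simp only [hessianForm, this]

end BlockNLP

end Hessian

/-! ### Quadratic growth near the regular solution. -/

theorem blockNorm_sq {T : ℕ} {n : Fin T → ℕ} (x : Blocks n) :
    blockNorm x ^ 2 = ∑ t, ‖x t‖ ^ 2 :=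
  Real.sq_sqrt (Finset.sum_nonneg fun _ _ => sq_nonneg _)

theorem blockNorm_pos {T : ℕ} {n : Fin T → ℕ} {x : Blocks n} (hx : x ≠ 0) : 0 < blockNorm x := by
  obtain ⟨t, ht⟩ := Function.ne_iff.1 hx
  refine Real.sqrt_pos.2 (lt_of_lt_of_le ?_
    (Finset.single_le_sum (f := fun t => ‖x t‖ ^ 2) (fun _ _ => sq_nonneg _) (Finset.mem_univ t)))
  have : 0 < ‖x t‖ := norm_pos_iff.2 ht
  positivity

namespace BlockNLP

variable {T m : ℕ} {n r : Fin T → ℕ} {P : BlockNLP T m n r}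

/-- Uniform quadratic growth with modulus `σ` at stationary points in the `R`-neighbourhood of
`xs` with multipliers in the `η`-neighbourhood of `lams`, for each block separately and for the
coupled problem. -/
def HasGrowth (P : BlockNLP T m n r) (θ : ℝ) (xs : Blocks n) (lams : Euc m) (σ R η : ℝ) : Prop :=
  ∀ (a y : Blocks n) (mu : Blocks r) (nu : Fin T → Euc m),
    (∀ t, ‖a t - xs t‖ < R ∧ a t ∈ P.X t) → (∀ t, ‖y t - xs t‖ < R ∧ y t ∈ P.X t) →
    (∀ t, ‖nu t - lams‖ < η ∧ IsKKTPoint (P.f t) (P.c t) (P.A t) (a t) (mu t) (nu t)) →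
    (∀ t, σ * ‖y t - a t‖ ^ 2 ≤ P.f t (y t) - P.f t (a t) + ⟪nu t, P.A t (y t - a t)⟫_ℝ
      + θ / 2 * ‖P.A t (y t - a t)‖ ^ 2) ∧
    σ * ∑ t, ‖y t - a t‖ ^ 2 ≤
      ∑ t, (P.f t (y t) - P.f t (a t) + ⟪nu t, P.A t (y t - a t)⟫_ℝ)
        + θ / 2 * ‖P.couple (y - a)‖ ^ 2

namespace IsRegularPenaltySolution

variable {θ : ℝ} {xs : Blocks n} {zs : Euc m} {mus : Blocks r} {lams : Euc m}

theorem isKKTPoint (h : P.IsRegularPenaltySolution θ xs zs mus lams) (t : Fin T) :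
    IsKKTPoint (P.f t) (P.c t) (P.A t) (xs t) (mus t) lams := fun w => by
  have := congrArg (fun v => ⟪v, w⟫_ℝ) (h.stationary_x t)
  simpa [inner_add_left, ContinuousLinearMap.adjoint_inner_left, inner_gradient_left] using this

theorem surjective_fderiv (h : P.IsRegularPenaltySolution θ xs zs mus lams) (t : Fin T) :
    Function.Surjective (fderiv ℝ (P.c t) (xs t)) := fun v => by
  obtain ⟨w, hw⟩ := h.licq (Pi.single t v, 0)
  refine ⟨w t, ?_⟩
  have := congrFun (congrArg Prod.fst hw) t
  simpa [jacobian] using this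

/-- The second order condition in the form of an unconstrained inequality. -/
theorem exists_posDef (h : P.IsRegularPenaltySolution θ xs zs mus lams) (hP : P.Standing) :
    ∃ σ > 0, ∃ K : ℝ, 0 ≤ K ∧ ∀ w : Blocks n, σ * ∑ t, ‖w t‖ ^ 2 ≤
      ∑ t, P.blockHessian xs mus t (w t) (w t) + θ * ‖P.couple w‖ ^ 2
        + K * ∑ t, ‖fderiv ℝ (P.c t) (xs t) (w t)‖ ^ 2 := by
  obtain ⟨σ, hσ, K, hK, hpos⟩ := exists_penalty_posDef (E := Blocks n)
    (q := fun w => ∑ t, P.blockHessian xs mus t (w t) (w t) + θ * ‖P.coupleL w‖ ^ 2)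
    (p := fun w => ∑ t, ‖fderiv ℝ (P.c t) (xs t) (w t)‖ ^ 2)
    (by fun_prop) (by fun_prop)
    (by
      intro s w
      simp only [Pi.smul_apply, map_smul, norm_smul, smul_apply, smul_eq_mul, mul_pow,
        Real.norm_eq_abs, sq_abs, mul_add, Finset.mul_sum]
      congr 1
      · exact Finset.sum_congr rfl fun _ _ => by ring
      · ring)
    (by
      intro s w
      simp only [Pi.smul_apply, map_smul, norm_smul, mul_pow, Real.norm_eq_abs, sq_abs,
        Finset.mul_sum])
    (fun w => Finset.sum_nonneg fun _ _ => sq_nonneg _)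
    (by
      intro w hw hz
      have hz' := (Finset.sum_eq_zero_iff_of_nonneg (fun _ _ => sq_nonneg _)).1 hz
      have := h.second_order w (-P.couple w) (fun t => by simpa using hz' t (Finset.mem_univ t))
        (by simp) (by linarith [blockNorm_pos hw, norm_nonneg (-P.couple w)])
      rw [hessianForm_penaltyLagrangian, hP.hessianForm_lagrangian,
        real_inner_self_eq_norm_sq, norm_neg] at this
      simpa [coupleL_apply] using this)
  -- The norm on `Blocks n` is the supremum norm, which costs a factor `T`; the `+ 1` avoids
  -- division by zero when there are no blocks.
  refine ⟨σ / (T + 1), by positivity, K, hK, fun w => le_trans ?_ (by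
    simpa [coupleL_apply] using hpos w)⟩
  have : ∑ t, ‖w t‖ ^ 2 ≤ T * ‖w‖ ^ 2 := by
    calc ∑ t, ‖w t‖ ^ 2 ≤ ∑ _t : Fin T, ‖w‖ ^ 2 := by
          gcongr with t
          exact norm_le_pi_norm w t
      _ = _ := by simp
  rw [div_mul_eq_mul_div, div_le_iff₀ (by positivity)]
  nlinarith [sq_nonneg ‖w‖]

/-- Half of the positive-definiteness inequality is compared with the blockwise second-order bounds.
The term `K ∑ ‖∇c_tᵀ d_t‖²` is negligible, since differences of nearby feasible points are almost
tangent. -/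
theorem exists_growth (h : P.IsRegularPenaltySolution θ xs zs mus lams) (hP : P.Standing) :
    ∃ σ > 0, ∃ R > 0, ∃ η > 0, P.HasGrowth θ xs lams σ R η := by
  obtain ⟨σ, hσ, K, hK, hpos⟩ := h.exists_posDef hP
  -- The Taylor error and half of the penalty term together cost `κ (K/2 + 1) = σ/4`, out of the
  -- available `σ/2`.
  set κ : ℝ := σ / (4 * (K / 2 + 1)) with hκ
  have hκ0 : 0 < κ := by positivity
  choose R hR η hη hb using fun t => (h.isKKTPoint t).exists_second_order_bound
    (hP.smooth_f t) (hP.smooth_c t) (h.surjective_fderiv t) hκ0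
  obtain ⟨R', hR', hRR⟩ : ∃ R' > 0, ∀ t, R' ≤ R t := by
    have := (Filter.eventually_all (l := 𝓝[>] (0 : ℝ)) (p := fun t x => x ≤ R t)).2 fun t =>
      nhdsWithin_le_nhds (Iic_mem_nhds (hR t))
    obtain ⟨x, hx1, hx2⟩ := (this.and self_mem_nhdsWithin).exists
    exact ⟨x, hx2, hx1⟩
  obtain ⟨η', hη', hηη⟩ : ∃ R' > 0, ∀ t, R' ≤ η t := by
    have := (Filter.eventually_all (l := 𝓝[>] (0 : ℝ)) (p := fun t x => x ≤ η t)).2 fun t =>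
      nhdsWithin_le_nhds (Iic_mem_nhds (hη t))
    obtain ⟨x, hx1, hx2⟩ := (this.and self_mem_nhdsWithin).exists
    exact ⟨x, hx2, hx1⟩
  refine ⟨σ / 4, by positivity, R', hR', η', hη', fun a y mu nu ha hy hnu => ?_⟩
  have hblk := fun t => hb t (a t) (by simpa [dist_eq_norm] using (ha t).1.trans_le (hRR t)) (y t)
    (by simpa [dist_eq_norm] using (hy t).1.trans_le (hRR t)) (ha t).2 (hy t).2 (mu t) (nu t)
    ((hnu t).1.trans_le (hηη t)) (hnu t).2
  have hκσ : κ * (K / 2 + 1) = σ / 4 := by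
    rw [hκ]; field_simp
  constructor
  · intro t
    -- A direction supported on one block turns `‖A w‖` into `‖A_t w_t‖`, which yields the separate
    -- growth of each block.
    have hp := hpos (Pi.single t (y t - a t))
    have e1 : ∑ s, ‖(Pi.single t (y t - a t) : Blocks n) s‖ ^ 2 = ‖y t - a t‖ ^ 2 := by
      rw [Finset.sum_eq_single t] <;> simp +contextual
    have e2 : ∑ s, P.blockHessian xs mus s ((Pi.single t (y t - a t) : Blocks n) s)
        ((Pi.single t (y t - a t) : Blocks n) s)
        = P.blockHessian xs mus t (y t - a t) (y t - a t) := by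
      rw [Finset.sum_eq_single t] <;> simp +contextual
    have e3 : ∑ s, ‖fderiv ℝ (P.c s) (xs s) ((Pi.single t (y t - a t) : Blocks n) s)‖ ^ 2
        = ‖fderiv ℝ (P.c t) (xs t) (y t - a t)‖ ^ 2 := by
      rw [Finset.sum_eq_single t] <;> simp +contextual
    have e4 : P.couple (Pi.single t (y t - a t)) = P.A t (y t - a t) := by
      unfold couple
      rw [Finset.sum_eq_single t] <;> simp +contextual
    rw [e1, e2, e3, e4] at hp
    obtain ⟨b1, b2⟩ := hblk t
    change 1 / 2 * P.blockHessian xs mus t (y t - a t) (y t - a t) - _ ≤ _ at b1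
    have b3 := mul_le_mul_of_nonneg_left b2 hK
    nlinarith [sq_nonneg ‖y t - a t‖]
  · have hp := hpos (y - a)
    have b1 := Finset.sum_le_sum fun t (_ : t ∈ Finset.univ) => (hblk t).1
    have b2 := Finset.sum_le_sum fun t (_ : t ∈ Finset.univ) => (hblk t).2
    change ∑ t, (1 / 2 * P.blockHessian xs mus t (y t - a t) (y t - a t) - _) ≤ _ at b1
    rw [Finset.sum_sub_distrib, ← Finset.mul_sum, ← Finset.mul_sum] at b1
    rw [← Finset.mul_sum] at b2
    simp only [Pi.sub_apply] at hp
    have b3 := mul_le_mul_of_nonneg_left b2 hK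
    nlinarith [Finset.sum_nonneg fun t (_ : t ∈ Finset.univ) => sq_nonneg ‖y t - a t‖]

end IsRegularPenaltySolution

end BlockNLP

/-! ### The proximal block subproblem. -/

section ProxCost

variable {E F M : Type*} [NormedAddCommGroup E] [InnerProductSpace ℝ E]
  [NormedAddCommGroup F] [InnerProductSpace ℝ F]
  [NormedAddCommGroup M] [InnerProductSpace ℝ M]

/-- The objective of a proximal augmented Lagrangian subproblem. -/
noncomputable def proxCost (f : E → ℝ) (A : E →L[ℝ] M) (ρ τ : ℝ) (lam p : M) (x₀ y : E) : ℝ :=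
  f y + ⟪lam, A y⟫_ℝ + ρ / 2 * ‖A y + p‖ ^ 2 + τ / 2 * ‖A (y - x₀)‖ ^ 2

/-- The multiplier estimate for which stationarity of `proxCost` at `a` is stationarity of
`f + ⟨ν, A ·⟩`. -/
noncomputable def proxMultiplier (A : E →L[ℝ] M) (ρ τ : ℝ) (lam p : M) (x₀ a : E) : M :=
  lam + ρ • (A a + p) + τ • A (a - x₀)

variable {f : E → ℝ} {A : E →L[ℝ] M} {ρ τ : ℝ} {lam p : M} {x₀ : E}

/-- Everything except `f` is quadratic, so the expansion about `a` is exact. Growth of `f + ⟨ν, A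
·⟩` augmented with `θ/2 ‖A ·‖²` thus passes to the subproblem as soon as `θ ≤ ρ + τ`. -/
theorem proxCost_sub (a y : E) :
    proxCost f A ρ τ lam p x₀ y - proxCost f A ρ τ lam p x₀ a =
      f y - f a + ⟪proxMultiplier A ρ τ lam p x₀ a, A (y - a)⟫_ℝ
        + (ρ + τ) / 2 * ‖A (y - a)‖ ^ 2 := by
  have e1 : A y + p = (A a + p) + A (y - a) := by rw [map_sub]; abel
  have e2 : A (y - x₀) = A (a - x₀) + A (y - a) := by rw [← map_add]; congr 1; abel
  have e3 : A y = A a + A (y - a) := by rw [map_sub]; abel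
  simp only [proxCost, proxMultiplier, inner_add_left, real_inner_smul_left]
  rw [e1, e2, norm_add_sq_real (A a + p), norm_add_sq_real (A (a - x₀)), e3, inner_add_right,
    inner_add_left]
  ring

theorem proxMultiplier_sub (a y : E) :
    proxMultiplier A ρ τ lam p x₀ y = proxMultiplier A ρ τ lam p x₀ a + (ρ + τ) • A (y - a) := by
  simp only [proxMultiplier, map_sub]
  module

theorem contDiff_proxCost {k : WithTop ℕ∞} (hf : ContDiff ℝ k f) :
    ContDiff ℝ k (proxCost f A ρ τ lam p x₀) := by
  have hA : ContDiff ℝ k A := A.contDiff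
  unfold proxCost
  refine ((hf.add (contDiff_const.inner ℝ hA)).add (contDiff_const.mul
    ((hA.add contDiff_const).norm_sq ℝ))).add (contDiff_const.mul (ContDiff.norm_sq ℝ ?_))
  exact A.contDiff.comp (contDiff_id.sub contDiff_const)

theorem fderiv_proxCost {a : E} (hf : DifferentiableAt ℝ f a) (w : E) :
    fderiv ℝ (proxCost f A ρ τ lam p x₀) a w
      = fderiv ℝ f a w + ⟪proxMultiplier A ρ τ lam p x₀ a, A w⟫_ℝ := by
  have h : HasFDerivAt (fun y => f y + ⟪proxMultiplier A ρ τ lam p x₀ a, A (y - a)⟫_ℝ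
      + (ρ + τ) / 2 * ‖A (y - a)‖ ^ 2 + (proxCost f A ρ τ lam p x₀ a - f a))
      (fderiv ℝ f a + (innerSL ℝ (proxMultiplier A ρ τ lam p x₀ a)).comp A) a := by
    have hA : HasFDerivAt (fun y => A (y - a)) A a :=
      A.hasFDerivAt.comp a ((hasFDerivAt_id a).sub_const a)
    have h2 := (hA.norm_sq).const_mul ((ρ + τ) / 2)
    refine (((hf.hasFDerivAt.add
      ((innerSL ℝ (proxMultiplier A ρ τ lam p x₀ a)).hasFDerivAt.comp a hA)).add
        h2).add_const _).congr_fderiv ?_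
    ext w
    simp
  have e : proxCost f A ρ τ lam p x₀ = fun y =>
      f y + ⟪proxMultiplier A ρ τ lam p x₀ a, A (y - a)⟫_ℝ
      + (ρ + τ) / 2 * ‖A (y - a)‖ ^ 2 + (proxCost f A ρ τ lam p x₀ a - f a) := by
    funext y
    have := proxCost_sub (f := f) (A := A) (ρ := ρ) (τ := τ) (lam := lam) (p := p) (x₀ := x₀) a y
    linarith
  rw [e, h.fderiv]
  simp

/-- Quadratic growth at `x` yields local minimizers of the perturbed subproblems near `x`. -/
theorem exists_isLocalMinimizer_proxCost [FiniteDimensional ℝ E] {X : Set E} {x : E} {ν : M}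
    {σ R : ℝ} (hf : Continuous f) (hX : IsClosed X) (hx : x ∈ X)
    (hgrowth : ∀ y ∈ X, ‖y - x‖ < R →
      σ * ‖y - x‖ ^ 2 ≤ f y - f x + ⟪ν, A (y - x)⟫_ℝ + (ρ + τ) / 2 * ‖A (y - x)‖ ^ 2)
    {δ : ℝ} (hδ : 0 < δ) (hδR : δ < R)
    (hν : ‖proxMultiplier A ρ τ lam p x₀ x - ν‖ * (‖A‖ + 1) < σ * δ) :
    ∃ y, IsLocalMinimizer (proxCost f A ρ τ lam p x₀) X y ∧ ‖y - x‖ < δ := by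
  have hcont : Continuous (proxCost f A ρ τ lam p x₀) := by
    unfold proxCost
    fun_prop
  obtain ⟨y, ⟨hyX, hyb⟩, hmin⟩ := ((isCompact_closedBall x δ).inter_left hX).exists_isMinOn
    ⟨x, hx, by simp [hδ.le]⟩ hcont.continuousOn
  have hyδ : ‖y - x‖ ≤ δ := by simpa [dist_eq_norm] using hyb
  have hlt : ‖y - x‖ < δ := by
    -- On the sphere of radius `δ`, growth contributes `σ δ²`, which exceeds the linear perturbation
    -- caused by the multiplier error; a minimizer over the closed ball is therefore interior.
    refine lt_of_le_of_ne hyδ fun heq => ?_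
    have h1 : proxCost f A ρ τ lam p x₀ y ≤ proxCost f A ρ τ lam p x₀ x :=
      hmin ⟨hx, by simp [hδ.le]⟩
    have h2 := proxCost_sub (f := f) (A := A) (ρ := ρ) (τ := τ) (lam := lam) (p := p)
      (x₀ := x₀) x y
    have h3 := hgrowth y hyX (heq ▸ hδR)
    have h4 : -⟪proxMultiplier A ρ τ lam p x₀ x - ν, A (y - x)⟫_ℝ
        ≤ ‖proxMultiplier A ρ τ lam p x₀ x - ν‖ * (‖A‖ + 1) * ‖y - x‖ := by
      refine (neg_le_abs _).trans ((abs_real_inner_le_norm _ _).trans ?_)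
      rw [mul_assoc]
      gcongr
      exact (A.le_opNorm _).trans (mul_le_mul_of_nonneg_right (by linarith) (norm_nonneg _))
    rw [inner_sub_left] at h4
    rw [heq] at h3 h4
    nlinarith
  refine ⟨y, ⟨hyX, ?_⟩, hlt⟩
  have hb : Metric.ball x δ ∈ 𝓝 y := Metric.isOpen_ball.mem_nhds (by simpa [dist_eq_norm] using hlt)
  filter_upwards [nhdsWithin_le_nhds hb, self_mem_nhdsWithin] with u hu1 hu2
  exact hmin ⟨hu2, Metric.ball_subset_closedBall hu1⟩

end ProxCost

/-! ### Descent inequalities for the energy and the Lyapunov function. -/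

theorem norm_sum_sq_le {M : Type*} [NormedAddCommGroup M] {T : ℕ} (a : Fin T → M) : ‖∑ t, a t‖ ^ 2 ≤ T * ∑ t, ‖a t‖ ^ 2 := by
  calc ‖∑ t, a t‖ ^ 2 ≤ (∑ t, ‖a t‖) ^ 2 := by
        gcongr
        exact norm_sum_le _ _
    _ ≤ _ := by simpa using sq_sum_le_card_mul_sum_sq (s := Finset.univ) (f := fun t => ‖a t‖)

/-- This makes the `D x` part of the energy nonnegative: parallel updates of `T` blocks cost a
factor `T`, which `τ` has to outweigh. -/
theorem weighted_sum_lower_bound {M : Type*} [NormedAddCommGroup M] {T : ℕ} {ρ τ : ℝ} (hρ : 0 ≤ ρ) (a : Fin T → M) :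
    (τ - (T - 1) * ρ) * ∑ t, ‖a t‖ ^ 2
      ≤ (ρ + τ) * ∑ t, ‖a t‖ ^ 2 - ρ * ‖∑ t, a t‖ ^ 2 := by
  nlinarith [mul_le_mul_of_nonneg_left (norm_sum_sq_le a) hρ]

section Algebra

variable {M : Type*} [NormedAddCommGroup M] [InnerProductSpace ℝ M]

/-- One step of the proximal Jacobi scheme decreases the weighted distance to the solution. Here
`a`, `z`, `l` and `a'`, `z'`, `l'` are the deviations from the solution before and after the
step, and `d`, `d'` the increments of `z`. -/
theorem energy_decrease {T : ℕ} {ρ θ τx τz N B : ℝ} (hρ : 0 < ρ) (hθ : 0 < θ) (hτz : 0 < τz)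
    (hτ : 0 ≤ τx - (T - 1) * ρ) {a a' : Fin T → M} {z z' l l' d : M}
    (hl : l' = l + ρ • (∑ t, a' t + z'))
    (hz : τz • d + θ • z + l = 0) (hz' : τz • (z' - z) + θ • z' + l' = 0)
    (hB : ‖∑ t, a' t‖ ^ 2 ≤ B)
    (hN : N ≤ -∑ t, ⟪l + ρ • (∑ s, a s + (a' t - a t) + z) + τx • (a' t - a t), a' t⟫_ℝ
      + θ * ‖∑ t, a' t‖ ^ 2) :
    ((ρ + τx) * ∑ t, ‖a' t‖ ^ 2 - ρ * ‖∑ t, a' t‖ ^ 2) + (ρ + τz) * ‖z'‖ ^ 2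
        + 1 / ρ * ‖l'‖ ^ 2 + τz * ‖z' - z‖ ^ 2 + 2 * N - 4 * θ ^ 2 / ρ * B
        + 2 * θ * ‖z' - z‖ ^ 2
      ≤ ((ρ + τx) * ∑ t, ‖a t‖ ^ 2 - ρ * ‖∑ t, a t‖ ^ 2) + (ρ + τz) * ‖z‖ ^ 2
        + 1 / ρ * ‖l‖ ^ 2 + τz * ‖d‖ ^ 2 := by
  set S := ∑ t, a t with hS
  set S' := ∑ t, a' t with hS'
  have e1 : ∑ t, ⟪l + ρ • (S + (a' t - a t) + z) + τx • (a' t - a t), a' t⟫_ℝ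
      = ⟪l + ρ • (S + z), S'⟫_ℝ + (ρ + τx) / 2 * (∑ t, ‖a' t‖ ^ 2 - ∑ t, ‖a t‖ ^ 2
        + ∑ t, ‖a' t - a t‖ ^ 2) := by
    rw [hS', inner_sum, ← Finset.sum_sub_distrib, ← Finset.sum_add_distrib, Finset.mul_sum,
      ← Finset.sum_add_distrib]
    refine Finset.sum_congr rfl fun t _ => ?_
    have : l + ρ • (S + (a' t - a t) + z) + τx • (a' t - a t)
        = l + ρ • (S + z) + (ρ + τx) • (a' t - a t) := by module
    rw [this, inner_add_left, real_inner_smul_left, norm_sub_sq_real, inner_sub_left,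
      real_inner_self_eq_norm_sq, real_inner_comm (a t) (a' t)]
    ring
  have e2 : (0 : ℝ) ≤ (ρ + τx) * ∑ t, ‖a' t - a t‖ ^ 2 - ρ * ‖S' - S‖ ^ 2 := by
    have := weighted_sum_lower_bound (τ := τx) hρ.le (fun t => a' t - a t)
    rw [Finset.sum_sub_distrib] at this
    exact (mul_nonneg hτ (Finset.sum_nonneg fun _ _ => sq_nonneg _)).trans this
  rw [e1] at hN
  obtain ⟨g, hg⟩ : ∃ g, g = S' + z' := ⟨_, rfl⟩
  have hS'g : S' = g - z' := by rw [hg]; abel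
  have hlg : l' = l + ρ • g := by rw [hl, hg]
  have hlz' : l' = -(τz • (z' - z) + θ • z') := by
    rw [eq_neg_iff_add_eq_zero, add_comm]; exact hz'
  have hlz : l = -(τz • d + θ • z) := by
    rw [eq_neg_iff_add_eq_zero, add_comm]; exact hz
  -- The coupling residual is expressed through two consecutive increments of `z`. Paired with `D`,
  -- it lets `τz ‖d‖²` in the energy pay for the cross term `⟪d, D⟫` and leaves `2θ‖D‖²` as a gain.
  have hgd : ρ • g = τz • d - (τz + θ) • (z' - z) := by
    have : ρ • g = l' - l := by rw [hlg]; abel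
    rw [this, hlz, hlz']
    module
  obtain ⟨D, hD⟩ : ∃ D, D = z' - z := ⟨_, rfl⟩
  have hzD : z = z' - D := by rw [hD]; abel
  rw [← hD] at hlz' hgd ⊢
  have q1 := congrArg (fun v => ⟪v, D⟫_ℝ) hgd
  simp only [inner_sub_left, real_inner_smul_left, real_inner_self_eq_norm_sq] at q1
  have f1 : 1 / ρ * ‖l'‖ ^ 2 - 1 / ρ * ‖l‖ ^ 2 = 2 * ⟪l', g⟫_ℝ - ρ * ‖g‖ ^ 2 := by
    have : l = l' - ρ • g := by rw [hlg]; abel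
    rw [this, norm_sub_sq_real, real_inner_smul_right, norm_smul, Real.norm_eq_abs, mul_pow, sq_abs]
    field_simp
    ring
  have f2 : l + ρ • (S + z) = l' - ρ • (S' - S) - ρ • D := by
    rw [hlg, hg, hD]; module
  rw [f2] at hN
  have f3 : ‖S‖ ^ 2 = ‖S'‖ ^ 2 - 2 * ⟪S' - S, S'⟫_ℝ + ‖S' - S‖ ^ 2 := by
    rw [norm_sub_sq_real, inner_sub_left, real_inner_self_eq_norm_sq, real_inner_comm S' S]
    ring
  simp only [inner_sub_left _ _ S', real_inner_smul_left] at hN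
  have f4 : ⟪l', S'⟫_ℝ = ⟪l', g⟫_ℝ + τz * ⟪D, z'⟫_ℝ + θ * ‖z'‖ ^ 2 := by
    rw [hS'g, inner_sub_right, hlz']
    simp only [inner_neg_left, inner_add_left, real_inner_smul_left, real_inner_self_eq_norm_sq]
    ring
  have f5 : ⟪D, S'⟫_ℝ = ⟪D, g⟫_ℝ - ⟪D, z'⟫_ℝ := by rw [hS'g, inner_sub_right]
  have f6 : ‖z‖ ^ 2 = ‖z'‖ ^ 2 - 2 * ⟪D, z'⟫_ℝ + ‖D‖ ^ 2 := by
    rw [hzD, norm_sub_sq_real, real_inner_comm]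
  have f7 : ‖z'‖ ^ 2 = ‖g‖ ^ 2 - 2 * ⟪g, S'⟫_ℝ + ‖S'‖ ^ 2 := by
    have : z' = g - S' := by rw [hg]; abel
    rw [this, norm_sub_sq_real]
  have f8 : ‖d - D‖ ^ 2 = ‖d‖ ^ 2 - 2 * ⟪d, D⟫_ℝ + ‖D‖ ^ 2 := norm_sub_sq_real _ _
  -- Young's inequality for the cross term left when `θ‖S'‖²` is traded for `θ‖z'‖² = θ‖g - S'‖²`.
  -- It uses up the `-ρ‖g‖²` of the multiplier update and is the source of `4θ²/ρ`.
  have f9 : -(2 * θ / ρ * ‖S'‖ ^ 2 * θ) ≤ ρ / 2 * ‖g‖ ^ 2 - 2 * θ * ⟪g, S'⟫_ℝ := by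
    have : 0 ≤ ‖ρ • g - (2 * θ) • S'‖ ^ 2 / (2 * ρ) := by positivity
    rw [norm_sub_sq_real, real_inner_smul_left, real_inner_smul_right, norm_smul, norm_smul,
      mul_pow, mul_pow, Real.norm_eq_abs, Real.norm_eq_abs, sq_abs, sq_abs] at this
    have e : (ρ ^ 2 * ‖g‖ ^ 2 - 2 * (ρ * (2 * θ * ⟪g, S'⟫_ℝ)) + (2 * θ) ^ 2 * ‖S'‖ ^ 2) / (2 * ρ)
        = ρ / 2 * ‖g‖ ^ 2 - 2 * θ * ⟪g, S'⟫_ℝ + 2 * θ / ρ * ‖S'‖ ^ 2 * θ := by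
      field_simp
    linarith
  have f10 : 4 * θ ^ 2 / ρ * ‖S'‖ ^ 2 ≤ 4 * θ ^ 2 / ρ * B := by gcongr
  have f11 : ⟪D, g⟫_ℝ = ⟪g, D⟫_ℝ := real_inner_comm _ _
  have f12 : ⟪S' - S, S'⟫_ℝ = ⟪S', S'⟫_ℝ - ⟪S, S'⟫_ℝ := inner_sub_left _ _ _
  have p1 : 0 ≤ τz * ‖d - D‖ ^ 2 := by positivity
  have p2 : 0 ≤ (ρ + τz) * ‖D‖ ^ 2 := by positivity
  have p3 : 0 ≤ 2 * θ * ‖g‖ ^ 2 := by positivity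
  linear_combination 2 * hN + e2 + f1 + ρ * f3 - 2 * f4 + 2 * ρ * f5 - (ρ + τz) * f6 + 2 * q1
    + 2 * ρ * f11 - 2 * ρ * f12 + τz * f8 + p1 - 2 * θ * f7 + p3 + 2 * f9 + f10 + p2

/-- Sufficient decrease of the Lyapunov function. Here `v t` is the increment of `A_t x_t`, `g`,
`g'` are the residuals of the coupling constraint, `d`, `d'` consecutive increments of `z`. -/
theorem lyapunov_decrease {T : ℕ} {ρ θ τx τz c c' : ℝ} (hρ : 0 < ρ) (hθ : 0 < θ) (hτz : 0 < τz)
    (hτx : 0 < τx / 4 - (T - 1) * ρ / 2) (hτρ : 0 < τz / 4 - 2 * (θ + τz) ^ 2 / ρ)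
    {v : Fin T → M} {z z' l l' g g' d : M} (hg : g' = g + ∑ t, v t + (z' - z))
    (hl : l' = l + ρ • g') (hz : τz • d + θ • z + l = 0)
    (hz' : τz • (z' - z) + θ • z' + l' = 0)
    (hv : c' - c + ∑ t, (⟪l + ρ • g, v t⟫_ℝ + (ρ + τx) / 2 * ‖v t‖ ^ 2) ≤ 0) :
    c' + θ / 2 * ‖z'‖ ^ 2 + ⟪l', g'⟫_ℝ + ρ / 2 * ‖g'‖ ^ 2 + τz / 4 * ‖z' - z‖ ^ 2
        + ∑ t, τx / 4 * ‖v t‖ ^ 2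
      ≤ c + θ / 2 * ‖z‖ ^ 2 + ⟪l, g⟫_ℝ + ρ / 2 * ‖g‖ ^ 2 + τz / 4 * ‖d‖ ^ 2 := by
  rw [Finset.sum_add_distrib, ← inner_sum, ← Finset.mul_sum] at hv
  rw [← Finset.mul_sum]
  have e1 := norm_sum_sq_le v
  set V := ∑ t, v t
  obtain ⟨D, hD⟩ : ∃ D, D = z' - z := ⟨_, rfl⟩
  rw [← hD] at hg hz' ⊢
  have hzD : z = z' - D := by rw [hD]; abel
  have hlz' : l' = -(τz • D + θ • z') := by
    rw [eq_neg_iff_add_eq_zero, add_comm]; exact hz'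
  have hlz : l = -(τz • d + θ • z) := by
    rw [eq_neg_iff_add_eq_zero, add_comm]; exact hz
  have hgd : ρ • g' = τz • d - (θ + τz) • D := by
    have : ρ • g' = l' - l := by rw [hl]; abel
    rw [this, hlz, hlz', hzD]
    module
  -- The multiplier update raises the augmented Lagrangian by `ρ‖g'‖²`. The condition on `τz` is
  -- what bounds this by `τz/4` times the two squared increments of `z`.
  have f1 : ρ * ‖g'‖ ^ 2 ≤ τz / 4 * (‖d‖ ^ 2 + ‖D‖ ^ 2) := by
    have h1 : ρ ^ 2 * ‖g'‖ ^ 2 = ‖ρ • g'‖ ^ 2 := by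
      rw [norm_smul, Real.norm_eq_abs, mul_pow, sq_abs]
    have h2 : ‖ρ • g'‖ ≤ τz * ‖d‖ + (θ + τz) * ‖D‖ := by
      rw [hgd]
      refine (norm_sub_le _ _).trans (le_of_eq ?_)
      rw [norm_smul, norm_smul, Real.norm_of_nonneg hτz.le, Real.norm_of_nonneg (by positivity)]
    have h3 : ‖ρ • g'‖ ^ 2 ≤ 2 * (θ + τz) ^ 2 * (‖d‖ ^ 2 + ‖D‖ ^ 2) := by
      calc ‖ρ • g'‖ ^ 2 ≤ (τz * ‖d‖ + (θ + τz) * ‖D‖) ^ 2 := by gcongr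
        _ ≤ ((θ + τz) * ‖d‖ + (θ + τz) * ‖D‖) ^ 2 := by gcongr; linarith
        _ ≤ _ := by
          have := mul_nonneg (sq_nonneg (θ + τz)) (sq_nonneg (‖d‖ - ‖D‖))
          linarith
    have h4 : 2 * (θ + τz) ^ 2 ≤ τz / 4 * ρ := by
      have := sub_pos.1 hτρ
      exact ((div_lt_iff₀ hρ).1 this).le
    have h5 : ρ * (ρ * ‖g'‖ ^ 2) ≤ ρ * (τz / 4 * (‖d‖ ^ 2 + ‖D‖ ^ 2)) := by
      calc ρ * (ρ * ‖g'‖ ^ 2) = ‖ρ • g'‖ ^ 2 := by rw [← h1]; ring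
        _ ≤ _ := h3
        _ ≤ τz / 4 * ρ * (‖d‖ ^ 2 + ‖D‖ ^ 2) := by gcongr
        _ = _ := by ring
    exact le_of_mul_le_mul_left h5 hρ
  have f2 : ‖z‖ ^ 2 = ‖z'‖ ^ 2 - 2 * ⟪z', D⟫_ℝ + ‖D‖ ^ 2 := by rw [hzD, norm_sub_sq_real]
  have f3 : ⟪l', D⟫_ℝ = -(τz * ‖D‖ ^ 2 + θ * ⟪z', D⟫_ℝ) := by
    rw [hlz', inner_neg_left, inner_add_left, real_inner_smul_left, real_inner_smul_left,
      real_inner_self_eq_norm_sq]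
  have f4 : ⟪l', g'⟫_ℝ = ⟪l, g⟫_ℝ + ⟪l, V⟫_ℝ + ⟪l, D⟫_ℝ + ρ * ‖g'‖ ^ 2 := by
    rw [hl, inner_add_left, real_inner_smul_left, real_inner_self_eq_norm_sq]
    nth_rewrite 1 [hg]
    rw [inner_add_right, inner_add_right]
  have f5 : ⟪l', D⟫_ℝ = ⟪l, D⟫_ℝ + ρ * ⟪g', D⟫_ℝ := by
    rw [hl, inner_add_left, real_inner_smul_left]
  have f6 : ‖g‖ ^ 2 + 2 * ⟪g, V⟫_ℝ + ‖V‖ ^ 2 = ‖g'‖ ^ 2 - 2 * ⟪g', D⟫_ℝ + ‖D‖ ^ 2 := by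
    rw [← norm_add_sq_real, ← norm_sub_sq_real, hg]
    congr 2
    abel
  rw [inner_add_left, real_inner_smul_left] at hv
  -- The price of updating all blocks simultaneously; the condition on `τx` covers it and also the
  -- term `τx/4` of the Lyapunov function.
  have e2 : ρ / 2 * ‖V‖ ^ 2 ≤ ρ / 2 * (T * ∑ t, ‖v t‖ ^ 2) := by gcongr
  have e3 : 0 ≤ ∑ t, ‖v t‖ ^ 2 := Finset.sum_nonneg fun _ _ => sq_nonneg _
  have e4 := mul_nonneg hτx.le e3
  have p1 : 0 ≤ (τz / 2 + ρ / 2 + θ / 2) * ‖D‖ ^ 2 := by positivity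
  linear_combination hv + e2 + e4 + p1 + f1 + f4 - f5 + f3 - θ / 2 * f2 - ρ / 2 * f6

end Algebra

theorem tendsto_zero_of_sufficient_decrease {E u : ℕ → ℝ} {c : ℝ} (hc : 0 < c)
    (hE : ∀ k, 0 ≤ E k) (hu : ∀ k, 0 ≤ u k) (h : ∀ k, E (k + 1) + c * u k ≤ E k) :
    Tendsto u atTop (𝓝 0) := by
  have hanti : Antitone E := antitone_nat_of_succ_le fun k => by
    linarith [h k, mul_nonneg hc.le (hu k)]
  have hlim := tendsto_atTop_ciInf hanti ⟨0, by rintro _ ⟨k, rfl⟩; exact hE k⟩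
  have hdiff := (hlim.sub (hlim.comp (tendsto_add_atTop_nat 1))).div_const c
  rw [sub_self, zero_div] at hdiff
  refine squeeze_zero hu (fun k => ?_) hdiff
  rw [le_div_iff₀ hc]
  have := h k
  simp only [Function.comp_apply]
  linarith

/-- The energy controls only `A_t x_t`; for injective `A_t` this recovers control of `x_t` itself.
-/
theorem exists_pos_forall_injective_le {T m : ℕ} {n : Fin T → ℕ}
    (A : (t : Fin T) → Euc (n t) →L[ℝ] Euc m) :
    ∃ κ > 0, ∀ t, Function.Injective (A t) → ∀ v, ‖v‖ ≤ κ * ‖A t v‖ := by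
  have h : ∀ t, ∃ κ : ℝ, 0 ≤ κ ∧ (Function.Injective (A t) → ∀ v, ‖v‖ ≤ κ * ‖A t v‖) := by
    intro t
    by_cases hi : Function.Injective (A t)
    · obtain ⟨K, -, hK⟩ := (A t : Euc (n t) →ₗ[ℝ] Euc m).injective_iff_antilipschitz.1 hi
      exact ⟨K, K.2, fun _ v => by simpa [dist_eq_norm] using hK.le_mul_dist v 0⟩
    · exact ⟨0, le_rfl, fun h => absurd h hi⟩
  choose κ hκ hA using h
  refine ⟨∑ t, κ t + 1, by linarith [Finset.sum_nonneg fun t (_ : t ∈ Finset.univ) => hκ t],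
    fun t hi v => (hA t hi v).trans ?_⟩
  gcongr
  linarith [Finset.single_le_sum (fun t _ => hκ t) (Finset.mem_univ t)]

/-! ### Localization of one step, and size of the energy. -/

namespace BlockNLP

variable {T m : ℕ} {n r : Fin T → ℕ} {P : BlockNLP T m n r}

/-- The coupling residual with the contribution of block `t` left out. -/
noncomputable def offset (P : BlockNLP T m n r) (x : Blocks n) (z : Euc m) (t : Fin T) : Euc m :=
  ∑ s ∈ Finset.univ.erase t, P.A s (x s) + z - P.b

theorem apply_add_offset (x : Blocks n) (z : Euc m) (t : Fin T) :
    P.A t (x t) + P.offset x z t = P.couple x + z - P.b := by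
  rw [offset, couple, ← Finset.add_sum_erase _ _ (Finset.mem_univ t)]
  abel

theorem subCost_eq_proxCost (ρ τx : ℝ) (x : Blocks n) (z lam : Euc m) (t : Fin T) :
    P.subCost ρ τx x z lam t = proxCost (P.f t) (P.A t) ρ τx lam (P.offset x z t) (x t) := by
  funext y
  simp only [subCost, proxCost, offset]
  congr 5
  abel

/-- The multiplier estimate of block `t` at the point `y`, given the previous iterate. -/
noncomputable def stepMultiplier (P : BlockNLP T m n r) (ρ τx : ℝ) (x : Blocks n) (z lam : Euc m)
    (t : Fin T) (y : Euc (n t)) : Euc m :=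
  proxMultiplier (P.A t) ρ τx lam (P.offset x z t) (x t) y

/-- Written in deviations from the solution, the multiplier error takes the form required by
`energy_decrease`. -/
theorem stepMultiplier_sub {ρ τx : ℝ} {xs x : Blocks n} {zs z : Euc m} (lams lam : Euc m)
    (hfeas : P.couple xs + zs = P.b) (t : Fin T) (y : Euc (n t)) :
    P.stepMultiplier ρ τx x z lam t y - lams = (lam - lams)
      + ρ • (∑ s, P.A s ((x - xs) s) + (P.A t (y - xs t) - P.A t ((x - xs) t)) + (z - zs))
      + τx • (P.A t (y - xs t) - P.A t ((x - xs) t)) := by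
  have h1 : P.A t y + P.offset x z t = P.couple x + z - P.b + P.A t (y - x t) := by
    rw [← apply_add_offset x z t, map_sub]; abel
  have h2 : ∑ s, P.A s ((x - xs) s) = P.couple x - P.couple xs := P.couple_sub x xs
  simp only [stepMultiplier, proxMultiplier]
  rw [h1, h2, ← hfeas]
  simp only [map_sub, Pi.sub_apply]
  module

theorem IsRegularPenaltySolution.exists_localization {θ : ℝ} {xs : Blocks n} {zs : Euc m}
    {mus : Blocks r} {lams : Euc m} (h : P.IsRegularPenaltySolution θ xs zs mus lams)
    (hP : P.Standing) {σ R η ρ τx : ℝ} (hσ : 0 < σ) (hR : 0 < R) (hη : 0 < η) (hρ : 0 < ρ)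
    (hρθ : θ ≤ ρ) (hτx : 0 < τx)
    (hgrowth : ∀ t, ∀ y ∈ P.X t, ‖y - xs t‖ < R → σ * ‖y - xs t‖ ^ 2 ≤
      P.f t y - P.f t (xs t) + ⟪lams, P.A t (y - xs t)⟫_ℝ + θ / 2 * ‖P.A t (y - xs t)‖ ^ 2) :
    ∃ s > 0, ∀ (x x' : Blocks n) (z lam : Euc m), (∀ t, ‖P.A t ((x - xs) t)‖ ≤ s) →
      ‖z - zs‖ ≤ s → ‖lam - lams‖ ≤ s →
      (∀ t,
        (Function.Injective (P.A t) →
          IsClosestLocalMinimizer (P.subCost ρ τx x z lam t) (P.X t) (x t) (x' t)) ∧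
        (¬ Function.Injective (P.A t) →
          IsClosestLocalMinimizer (P.subCost ρ τx x z lam t) (P.X t) (xs t) (x' t))) →
      ∀ t, ‖x' t - xs t‖ < R ∧ ‖P.stepMultiplier ρ τx x z lam t (x' t) - lams‖ < η := by
  obtain ⟨κ, hκ, hinj⟩ := exists_pos_forall_injective_le P.A
  set α : ℝ := ∑ t, ‖P.A t‖ + 1 with hα
  have hα0 : 0 < α := by positivity
  have hAα : ∀ t, ‖P.A t‖ + 1 ≤ α := fun t => by
    rw [hα]
    linarith [Finset.single_le_sum (f := fun t => ‖P.A t‖) (fun t _ => norm_nonneg _)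
      (Finset.mem_univ t)]
  set δ : ℝ := min (R / 2) (η / (4 * (ρ + τx) * α)) with hδ
  have hδ0 : 0 < δ := by positivity
  have hδR : δ < R := (min_le_left _ _).trans_lt (by linarith)
  have hδη : (ρ + τx) * α * δ ≤ η / 4 := by
    calc (ρ + τx) * α * δ ≤ (ρ + τx) * α * (η / (4 * (ρ + τx) * α)) := by
          gcongr
          exact min_le_right _ _
      _ = η / 4 := by field_simp
  set C : ℝ := 1 + ρ * (T + 2) + τx with hC
  have hC0 : 0 < C := by positivity
  -- The three bounds serve, in order, closeness of `x t` when `A_t` is injective, the multiplier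
  -- error `C s` at `xs t`, and the existence of a local minimizer within `δ/3` of `xs t`.
  set s : ℝ := min (δ / (3 * κ)) (min (η / (4 * C)) (σ * δ / (6 * (C * α)))) with hs
  have hs0 : 0 < s := by positivity
  have hs1 : κ * s ≤ δ / 3 := by
    calc κ * s ≤ κ * (δ / (3 * κ)) := by gcongr; exact min_le_left _ _
      _ = δ / 3 := by field_simp
  have hs2 : C * s ≤ η / 4 := by
    calc C * s ≤ C * (η / (4 * C)) := by
          gcongr
          exact (min_le_right _ _).trans (min_le_left _ _)
      _ = η / 4 := by field_simp
  have hs3 : C * s * α ≤ σ * δ / 6 := by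
    calc C * s * α = C * α * s := by ring
      _ ≤ C * α * (σ * δ / (6 * (C * α))) := by
          gcongr
          exact (min_le_right _ _).trans (min_le_right _ _)
      _ = σ * δ / 6 := by field_simp
  have hfeas : P.couple xs + zs = P.b := h.local_solution.1.2
  have hxs : ∀ t, xs t ∈ P.X t := h.local_solution.1.1
  refine ⟨s, hs0, fun x x' z lam hx hz hlam hsel t => ?_⟩
  have hmult : ‖P.stepMultiplier ρ τx x z lam t (xs t) - lams‖ ≤ C * s := by
    rw [stepMultiplier_sub lams lam hfeas, sub_self, map_zero, zero_sub]
    have hsum : ‖∑ s, P.A s ((x - xs) s)‖ ≤ T * s := by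
      refine (norm_sum_le _ _).trans ((Finset.sum_le_sum fun t _ => hx t).trans ?_)
      simp
    have h1 : ‖∑ s, P.A s ((x - xs) s) + -P.A t ((x - xs) t) + (z - zs)‖ ≤ T * s + s + s := by
      refine (norm_add₃_le).trans ?_
      rw [norm_neg]
      gcongr
      exact hx t
    refine norm_add₃_le.trans ?_
    rw [norm_smul, norm_smul, norm_neg, Real.norm_of_nonneg hρ.le, Real.norm_of_nonneg hτx.le]
    calc _ ≤ s + ρ * (T * s + s + s) + τx * s := by
          gcongr
          exact hx t
      _ = C * s := by rw [hC]; ring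
  obtain ⟨y, hy, hyδ⟩ := exists_isLocalMinimizer_proxCost (f := P.f t) (A := P.A t) (ρ := ρ)
    (τ := τx) (lam := lam) (p := P.offset x z t) (x₀ := x t) (X := P.X t) (x := xs t) (ν := lams)
    (σ := σ) (R := R) (δ := δ / 3) (hP.smooth_f t).continuous (hP.nonempty_compact t).2.isClosed
    (hxs t) (fun y hy hyR => (hgrowth t y hy hyR).trans (by gcongr; linarith)) (by positivity)
    (by linarith) (by
      change ‖P.stepMultiplier ρ τx x z lam t (xs t) - lams‖ * _ < _
      calc _ ≤ C * s * α := by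
            gcongr
            exact hAα t
        _ ≤ σ * δ / 6 := hs3
        _ < σ * (δ / 3) := by
          have : 0 < σ * δ := by positivity
          linarith)
  rw [← subCost_eq_proxCost] at hy
  -- For injective `A_t` the selection compares distances to `x t`, so the triangle inequality uses
  -- three pieces of size `δ/3`. Otherwise `x t` may be far from `xs t`, and the selection relative
  -- to `xs t` gives the bound directly.
  have hclose : ‖x' t - xs t‖ ≤ δ := by
    by_cases hi : Function.Injective (P.A t)
    · have h1 := ((hsel t).1 hi).2 y hy
      have h2 : ‖x t - xs t‖ ≤ δ / 3 := by
        refine (hinj t hi _).trans (le_trans ?_ hs1)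
        gcongr
        exact hx t
      have h3 : ‖y - x t‖ ≤ ‖y - xs t‖ + ‖x t - xs t‖ := by
        rw [norm_sub_rev (x t)]; exact norm_sub_le_norm_sub_add_norm_sub _ _ _
      have h4 : ‖x' t - xs t‖ ≤ ‖x' t - x t‖ + ‖x t - xs t‖ :=
        norm_sub_le_norm_sub_add_norm_sub _ _ _
      linarith
    · have h1 := ((hsel t).2 hi).2 y hy
      linarith
  refine ⟨hclose.trans_lt hδR, ?_⟩
  have e : P.stepMultiplier ρ τx x z lam t (x' t) - lams
      = (P.stepMultiplier ρ τx x z lam t (xs t) - lams)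
        + (ρ + τx) • P.A t (x' t - xs t) := by
    rw [stepMultiplier, proxMultiplier_sub (xs t), stepMultiplier]
    abel
  rw [e]
  refine (norm_add_le _ _).trans_lt ?_
  rw [norm_smul, Real.norm_of_nonneg (by positivity)]
  have h5 : ‖P.A t (x' t - xs t)‖ ≤ α * δ :=
    ((P.A t).le_opNorm _).trans (by
      gcongr
      linarith [hAα t])
  have h6 : (ρ + τx) * ‖P.A t (x' t - xs t)‖ ≤ (ρ + τx) * α * δ := by
    rw [mul_assoc]; gcongr
  linarith

/-- The square of `rateNorm`, without the square root. -/
noncomputable def energy (P : BlockNLP T m n r) (ρ τx τz : ℝ) (x : Blocks n) (z lam δ : Euc m) :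
    ℝ :=
  ((ρ + τx) * ∑ t, ‖P.A t (x t)‖ ^ 2 - ρ * ‖P.couple x‖ ^ 2)
    + (ρ + τz) * ‖z‖ ^ 2 + 1 / ρ * ‖lam‖ ^ 2 + τz * ‖δ‖ ^ 2

theorem rateNorm_eq_sqrt_energy (ρ τx τz : ℝ) (x : Blocks n) (z lam δ : Euc m) :
    P.rateNorm ρ τx τz x z lam δ = Real.sqrt (P.energy ρ τx τz x z lam δ) := rfl

theorem energy_lower_bound {ρ τx τz : ℝ} (hρ : 0 < ρ) (x : Blocks n) (z lam δ : Euc m) :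
    (τx - (T - 1) * ρ) * ∑ t, ‖P.A t (x t)‖ ^ 2 + (ρ + τz) * ‖z‖ ^ 2 + 1 / ρ * ‖lam‖ ^ 2
      + τz * ‖δ‖ ^ 2 ≤ P.energy ρ τx τz x z lam δ := by
  have := weighted_sum_lower_bound (τ := τx) hρ.le fun t => P.A t (x t)
  simp only [energy, couple]
  linarith

theorem energy_nonneg {ρ τx τz : ℝ} (hρ : 0 < ρ) (hτz : 0 < τz) (hτ : 0 < τx - (T - 1) * ρ)
    (x : Blocks n) (z lam δ : Euc m) : 0 ≤ P.energy ρ τx τz x z lam δ := by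
  refine le_trans ?_ (energy_lower_bound hρ x z lam δ)
  have := Finset.sum_nonneg fun t (_ : t ∈ Finset.univ) => sq_nonneg ‖P.A t (x t)‖
  positivity

/-- The energy is equivalent to the squared scaled norm. The second half takes `δ = 0` because the
initialization `λ⁰ = -θ z⁰` gives `Δz⁰ = 0`. -/
theorem exists_energy_bounds (P : BlockNLP T m n r) {ρ τx τz : ℝ} (hρ : 0 < ρ) (hτx : 0 < τx)
    (hτz : 0 < τz) (hτ : 0 < τx - (T - 1) * ρ) {s : ℝ} (hs : 0 < s) :
    ∃ e > 0, ∃ ε > 0,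
      (∀ (x : Blocks n) (z lam δ : Euc m), P.energy ρ τx τz x z lam δ ≤ e →
        (∀ t, ‖P.A t (x t)‖ ≤ s) ∧ ‖z‖ ≤ s ∧ ‖lam‖ ≤ s) ∧
      ∀ (x : Blocks n) (z lam : Euc m), P.scaledNorm x z lam < ε →
        P.energy ρ τx τz x z lam 0 ≤ e := by
  set c₁ : ℝ := (ρ + τx) + (ρ + τz) + 1 / ρ with hc₁
  set c₂ : ℝ := min (τx - (T - 1) * ρ) (min (ρ + τz) (1 / ρ)) with hc₂
  have hρ' : 0 < 1 / ρ := by positivity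
  have h1 : 0 < c₁ := by positivity
  have h2 : 0 < c₂ := lt_min hτ (lt_min (by positivity) hρ')
  refine ⟨c₂ * s ^ 2, by positivity, Real.sqrt (c₂ * s ^ 2 / c₁), by positivity, ?_, ?_⟩
  · intro x z lam δ h
    have h3 := (energy_lower_bound hρ x z lam δ).trans h
    have hS : 0 ≤ ∑ t, ‖P.A t (x t)‖ ^ 2 := Finset.sum_nonneg fun _ _ => sq_nonneg _
    have h4 : c₂ * ∑ t, ‖P.A t (x t)‖ ^ 2 ≤ (τx - (T - 1) * ρ) * ∑ t, ‖P.A t (x t)‖ ^ 2 := by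
      gcongr
      exact min_le_left _ _
    have h5 : c₂ * ‖z‖ ^ 2 ≤ (ρ + τz) * ‖z‖ ^ 2 := by
      gcongr
      exact (min_le_right _ _).trans (min_le_left _ _)
    have h6 : c₂ * ‖lam‖ ^ 2 ≤ 1 / ρ * ‖lam‖ ^ 2 := by
      gcongr
      exact (min_le_right _ _).trans (min_le_right _ _)
    have p1 : 0 ≤ c₂ * ∑ t, ‖P.A t (x t)‖ ^ 2 := by positivity
    have p2 : 0 ≤ c₂ * ‖z‖ ^ 2 := by positivity
    have p3 : 0 ≤ c₂ * ‖lam‖ ^ 2 := by positivity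
    have p4 : 0 ≤ τz * ‖δ‖ ^ 2 := by positivity
    have aux : ∀ v : ℝ, c₂ * v ^ 2 ≤ c₂ * s ^ 2 → v ≤ s := fun v hv =>
      le_of_sq_le_sq (le_of_mul_le_mul_left hv h2) hs.le
    refine ⟨fun t => aux _ (le_trans ?_ (by linarith : c₂ * ∑ t, ‖P.A t (x t)‖ ^ 2 ≤ _)),
      aux _ (by linarith), aux _ (by linarith)⟩
    gcongr
    exact Finset.single_le_sum (f := fun t => ‖P.A t (x t)‖ ^ 2) (fun _ _ => sq_nonneg _)
      (Finset.mem_univ t)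
  · intro x z lam h
    have hS : 0 ≤ ∑ t, ‖P.A t (x t)‖ ^ 2 := Finset.sum_nonneg fun _ _ => sq_nonneg _
    have h3 := Real.lt_sqrt (Real.sqrt_nonneg _) |>.1 h
    change Real.sqrt _ ^ 2 < _ at h3
    rw [Real.sq_sqrt (by positivity), lt_div_iff₀ h1] at h3
    have p0 : 0 ≤ ρ * ‖P.couple x‖ ^ 2 := by positivity
    have p1 : (ρ + τx) * ∑ t, ‖P.A t (x t)‖ ^ 2 ≤ c₁ * ∑ t, ‖P.A t (x t)‖ ^ 2 := by
      gcongr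
      rw [hc₁]; linarith
    have p2 : (ρ + τz) * ‖z‖ ^ 2 ≤ c₁ * ‖z‖ ^ 2 := by
      gcongr
      rw [hc₁]; linarith
    have p3 : 1 / ρ * ‖lam‖ ^ 2 ≤ c₁ * ‖lam‖ ^ 2 := by
      gcongr
      rw [hc₁]; linarith
    simp only [energy, norm_zero]
    linarith

/-! ### Relations along one iteration. -/

namespace IsIterates

variable {ρ θ τx τz : ℝ} {x : ℕ → Blocks n} {z lam : ℕ → Euc m}

/-- For positive indices this is the optimality condition of the `z`-update after inserting the
multiplier update; `Δz⁰` is defined so that it also holds at the start. -/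
theorem deltaZ_relation (h : P.IsIterates ρ θ τx τz x z lam) (hτz : 0 < τz) (hρ : 0 < ρ)
    (hθ : 0 < θ) (k : ℕ) : τz • deltaZ θ τz z lam k + θ • z k + lam k = 0 := by
  cases k with
  | zero =>
    simp only [deltaZ, smul_neg, smul_smul, mul_inv_cancel₀ hτz.ne', one_smul]
    abel
  | succ k =>
    have hs : τz + ρ + θ ≠ 0 := by positivity
    have h1 : (τz + ρ + θ) • z (k + 1)
        = τz • z k - ρ • (P.couple (x (k + 1)) - P.b) - lam k := by
      rw [h.z_update k, smul_smul, mul_inv_cancel₀ hs, one_smul]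
    have h2 := h.lam_update k
    have h3 : lam k = τz • z k - ρ • (P.couple (x (k + 1)) - P.b) - (τz + ρ + θ) • z (k + 1) := by
      rw [h1]; abel
    simp only [deltaZ]
    rw [h2, h3]
    module

theorem mem_X (h : P.IsIterates ρ θ τx τz x z lam) (k : ℕ) (t : Fin T) : x k t ∈ P.X t := by
  cases k with
  | zero => exact h.start t
  | succ k => exact (h.x_update k t).1

theorem exists_multiplier (h : P.IsIterates ρ θ τx τz x z lam) (hP : P.Standing)
    (hlicq : P.SubproblemLICQ x) (k : ℕ) :
    ∃ mu : Blocks r, ∀ t, IsKKTPoint (P.f t) (P.c t) (P.A t) (x (k + 1) t) (mu t)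
      (P.stepMultiplier ρ τx (x k) (z k) (lam k) t (x (k + 1) t)) := by
  have : ∀ t, ∃ mu, IsKKTPoint (P.f t) (P.c t) (P.A t) (x (k + 1) t) mu
      (P.stepMultiplier ρ τx (x k) (z k) (lam k) t (x (k + 1) t)) := fun t => by
    have hmin := h.x_update k t
    rw [subCost_eq_proxCost] at hmin
    exact exists_isKKTPoint (hP.smooth_c t)
      (contDiff_proxCost ((hP.smooth_f t).of_le (by norm_num))) hmin (hlicq k t)
      (fderiv_proxCost ((hP.smooth_f t).differentiable (by simp) _))
  exact ⟨fun t => (this t).choose, fun t => (this t).choose_spec⟩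

end IsIterates

theorem exists_norm_couple_sq_le (P : BlockNLP T m n r) :
    ∃ B : ℝ, 0 ≤ B ∧ ∀ w : Blocks n, ‖P.couple w‖ ^ 2 ≤ B * ∑ t, ‖w t‖ ^ 2 := by
  refine ⟨‖P.coupleL‖ ^ 2, sq_nonneg _, fun w => ?_⟩
  have hS : 0 ≤ ∑ t, ‖w t‖ ^ 2 := Finset.sum_nonneg fun _ _ => sq_nonneg _
  have h1 : ‖w‖ ≤ Real.sqrt (∑ t, ‖w t‖ ^ 2) := by
    refine (pi_norm_le_iff_of_nonneg (Real.sqrt_nonneg _)).2 fun t => Real.le_sqrt_of_sq_le ?_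
    exact Finset.single_le_sum (f := fun t => ‖w t‖ ^ 2) (fun _ _ => sq_nonneg _)
      (Finset.mem_univ t)
  rw [← coupleL_apply]
  calc ‖P.coupleL w‖ ^ 2 ≤ (‖P.coupleL‖ * Real.sqrt (∑ t, ‖w t‖ ^ 2)) ^ 2 := by
        gcongr
        exact (P.coupleL.le_opNorm w).trans (by gcongr)
    _ = _ := by rw [mul_pow, Real.sq_sqrt hS]

namespace IsIterates

variable {ρ θ τx τz : ℝ} {x : ℕ → Blocks n} {z lam : ℕ → Euc m}

theorem energy_step (h : P.IsIterates ρ θ τx τz x z lam) {xs : Blocks n} {zs : Euc m}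
    {mus : Blocks r} {lams : Euc m} (hsol : P.IsRegularPenaltySolution θ xs zs mus lams)
    {σ R η B : ℝ} (hR : 0 < R) (hη : 0 < η) (hg : P.HasGrowth θ xs lams σ R η)
    (hB : ∀ w : Blocks n, ‖P.couple w‖ ^ 2 ≤ B * ∑ t, ‖w t‖ ^ 2)
    (hρ : 0 < ρ) (hθ : 0 < θ) (hτz : 0 < τz) (hτ : 0 < τx - (T - 1) * ρ)
    (hρB : 4 * θ ^ 2 * B ≤ σ * ρ) {mu : Blocks r} {k : ℕ}
    (hloc : ∀ t, ‖x (k + 1) t - xs t‖ < R ∧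
      ‖P.stepMultiplier ρ τx (x k) (z k) (lam k) t (x (k + 1) t) - lams‖ < η)
    (hmu : ∀ t, IsKKTPoint (P.f t) (P.c t) (P.A t) (x (k + 1) t) (mu t)
      (P.stepMultiplier ρ τx (x k) (z k) (lam k) t (x (k + 1) t))) :
    P.energy ρ τx τz (x (k + 1) - xs) (z (k + 1) - zs) (lam (k + 1) - lams)
        (deltaZ θ τz z lam (k + 1)) + 3 * σ * blockNorm (x (k + 1) - xs) ^ 2
        + 2 * θ * ‖deltaZ θ τz z lam (k + 1)‖ ^ 2
      ≤ P.energy ρ τx τz (x k - xs) (z k - zs) (lam k - lams) (deltaZ θ τz z lam k) := by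
  have hfeas : P.couple xs + zs = P.b := hsol.local_solution.1.2
  have hxs : ∀ t, ‖xs t - xs t‖ < R ∧ xs t ∈ P.X t := fun t =>
    ⟨by simpa using hR, hsol.local_solution.1.1 t⟩
  have hx1 : ∀ t, ‖x (k + 1) t - xs t‖ < R ∧ x (k + 1) t ∈ P.X t := fun t =>
    ⟨(hloc t).1, h.mem_X (k + 1) t⟩
  -- Growth in both directions: in the sum the values of `f` cancel, leaving strong monotonicity
  -- with constant `2σ`.
  have g1 := (hg _ _ _ _ hx1 hxs fun t => ⟨(hloc t).2, hmu t⟩).2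
  have g2 := (hg _ _ _ (fun _ => lams) hxs hx1 fun t =>
    ⟨by simpa using hη, hsol.isKKTPoint t⟩).2
  have hN : 2 * σ * ∑ t, ‖(x (k + 1) - xs) t‖ ^ 2 ≤
      -∑ t, ⟪(lam k - lams) + ρ • (∑ s, P.A s ((x k - xs) s)
        + (P.A t ((x (k + 1) - xs) t) - P.A t ((x k - xs) t)) + (z k - zs))
        + τx • (P.A t ((x (k + 1) - xs) t) - P.A t ((x k - xs) t)),
          P.A t ((x (k + 1) - xs) t)⟫_ℝ + θ * ‖P.couple (x (k + 1) - xs)‖ ^ 2 := by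
    have e1 : ∀ t, ‖xs t - x (k + 1) t‖ ^ 2 = ‖(x (k + 1) - xs) t‖ ^ 2 := fun t => by
      rw [norm_sub_rev]; rfl
    have e2 : ‖P.couple (xs - x (k + 1))‖ ^ 2 = ‖P.couple (x (k + 1) - xs)‖ ^ 2 := by
      rw [couple_sub, norm_sub_rev, ← couple_sub]
    simp only [e1, e2] at g1
    have e3 : ∑ t, (P.f t (xs t) - P.f t (x (k + 1) t)
          + ⟪P.stepMultiplier ρ τx (x k) (z k) (lam k) t (x (k + 1) t),
            P.A t (xs t - x (k + 1) t)⟫_ℝ)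
        + ∑ t, (P.f t (x (k + 1) t) - P.f t (xs t) + ⟪lams, P.A t (x (k + 1) t - xs t)⟫_ℝ)
        = -∑ t, ⟪(lam k - lams) + ρ • (∑ s, P.A s ((x k - xs) s)
        + (P.A t ((x (k + 1) - xs) t) - P.A t ((x k - xs) t)) + (z k - zs))
        + τx • (P.A t ((x (k + 1) - xs) t) - P.A t ((x k - xs) t)),
          P.A t ((x (k + 1) - xs) t)⟫_ℝ := by
      rw [← Finset.sum_add_distrib, ← Finset.sum_neg_distrib]
      refine Finset.sum_congr rfl fun t _ => ?_
      have e4 := stepMultiplier_sub (ρ := ρ) (τx := τx) (x := x k) (z := z k) lams (lam k) hfeas t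
        (x (k + 1) t)
      change _ = -⟪(lam k - lams) + ρ • (∑ s, P.A s ((x k - xs) s)
        + (P.A t (x (k + 1) t - xs t) - P.A t ((x k - xs) t)) + (z k - zs))
        + τx • (P.A t (x (k + 1) t - xs t) - P.A t ((x k - xs) t)),
          P.A t (x (k + 1) t - xs t)⟫_ℝ
      rw [← e4, ← neg_sub (x (k + 1) t) (xs t), map_neg, inner_neg_right, inner_sub_left]
      ring
    simp only [Pi.sub_apply] at g1 g2 e3 ⊢
    linarith
  have hz := h.deltaZ_relation hτz hρ hθ k
  have hz' := h.deltaZ_relation hτz hρ hθ (k + 1)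
  have hs := hsol.stationary_z
  have key := energy_decrease (a := fun t => P.A t ((x k - xs) t))
    (a' := fun t => P.A t ((x (k + 1) - xs) t)) (z := z k - zs) (z' := z (k + 1) - zs)
    (l := lam k - lams) (l' := lam (k + 1) - lams) (d := deltaZ θ τz z lam k) hρ hθ hτz hτ.le
    (by
      change _ = _ + ρ • (P.couple (x (k + 1) - xs) + _)
      rw [h.lam_update k, couple_sub, ← hfeas]
      module)
    (by
      have e : τz • deltaZ θ τz z lam k + θ • (z k - zs) + (lam k - lams)
        = (τz • deltaZ θ τz z lam k + θ • z k + lam k) - (θ • zs + lams) := by module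
      rw [e, hz, hs, sub_zero])
    (by
      have e : τz • (z (k + 1) - zs - (z k - zs)) + θ • (z (k + 1) - zs) + (lam (k + 1) - lams)
        = (τz • (z (k + 1) - z k) + θ • z (k + 1) + lam (k + 1)) - (θ • zs + lams) := by module
      rw [e, hs, sub_zero]
      exact hz') (hB (x (k + 1) - xs)) hN
  have e5 : z (k + 1) - zs - (z k - zs) = deltaZ θ τz z lam (k + 1) := by
    simp only [deltaZ]; abel
  rw [e5] at key
  have hS : 0 ≤ ∑ t, ‖(x (k + 1) - xs) t‖ ^ 2 := Finset.sum_nonneg fun _ _ => sq_nonneg _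
  -- The lower bound on `ρ` reduces the gain `2 · 2σ` only to `3σ`.
  have h6 : 4 * θ ^ 2 / ρ * (B * ∑ t, ‖(x (k + 1) - xs) t‖ ^ 2)
      ≤ σ * ∑ t, ‖(x (k + 1) - xs) t‖ ^ 2 := by
    rw [← mul_assoc]
    gcongr
    rw [div_mul_eq_mul_div, div_le_iff₀ hρ]
    exact hρB
  rw [blockNorm_sq]
  simp only [energy, couple]
  linarith

/-- Local minimality alone does not compare the new block with the old one; growth at the new
stationary point does, provided both lie near `xs`. The comparison starts from `x (k + 1)`, since `x
0` need not be near `xs` in blocks where `A_t` is not injective. -/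
theorem lyapunov_step (h : P.IsIterates ρ θ τx τz x z lam) {xs : Blocks n} {lams : Euc m}
    {σ R η : ℝ} (hg : P.HasGrowth θ xs lams σ R η) (hσ : 0 < σ)
    (hρ : 0 < ρ) (hθ : 0 < θ) (hτz : 0 < τz) (hρθ : θ ≤ ρ) (hτx0 : 0 < τx)
    (hτx : 0 < τx / 4 - (T - 1) * ρ / 2) (hτρ : 0 < τz / 4 - 2 * (θ + τz) ^ 2 / ρ)
    {mu : Blocks r} {k : ℕ} (hk : ∀ t, ‖x (k + 1) t - xs t‖ < R)
    (hloc : ∀ t, ‖x (k + 2) t - xs t‖ < R ∧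
      ‖P.stepMultiplier ρ τx (x (k + 1)) (z (k + 1)) (lam (k + 1)) t (x (k + 2) t) - lams‖ < η)
    (hmu : ∀ t, IsKKTPoint (P.f t) (P.c t) (P.A t) (x (k + 2) t) (mu t)
      (P.stepMultiplier ρ τx (x (k + 1)) (z (k + 1)) (lam (k + 1)) t (x (k + 2) t))) :
    P.lyapunov ρ θ τx τz (x (k + 2)) (z (k + 2)) (lam (k + 2)) (x (k + 1)) (z (k + 1))
      ≤ P.lyapunov ρ θ τx τz (x (k + 1)) (z (k + 1)) (lam (k + 1)) (x k) (z k) := by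
  have g := (hg _ _ _ _ (fun t => ⟨(hloc t).1, h.mem_X (k + 2) t⟩)
    (fun t => ⟨hk t, h.mem_X (k + 1) t⟩) fun t => ⟨(hloc t).2, hmu t⟩).1
  have hv : P.cost (x (k + 2)) - P.cost (x (k + 1))
      + ∑ t, (⟪lam (k + 1) + ρ • (P.couple (x (k + 1)) + z (k + 1) - P.b),
        P.A t (x (k + 2) t - x (k + 1) t)⟫_ℝ
          + (ρ + τx) / 2 * ‖P.A t (x (k + 2) t - x (k + 1) t)‖ ^ 2) ≤ 0 := by
    rw [cost, cost, ← Finset.sum_sub_distrib, ← Finset.sum_add_distrib]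
    refine Finset.sum_nonpos fun t _ => ?_
    have e1 := proxCost_sub (f := P.f t) (A := P.A t) (ρ := ρ) (τ := τx) (lam := lam (k + 1))
      (p := P.offset (x (k + 1)) (z (k + 1)) t) (x₀ := x (k + 1) t) (x (k + 1) t) (x (k + 2) t)
    have e2 := proxCost_sub (f := P.f t) (A := P.A t) (ρ := ρ) (τ := τx) (lam := lam (k + 1))
      (p := P.offset (x (k + 1)) (z (k + 1)) t) (x₀ := x (k + 1) t) (x (k + 2) t) (x (k + 1) t)
    have e3 : proxMultiplier (P.A t) ρ τx (lam (k + 1)) (P.offset (x (k + 1)) (z (k + 1)) t)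
        (x (k + 1) t) (x (k + 1) t)
        = lam (k + 1) + ρ • (P.couple (x (k + 1)) + z (k + 1) - P.b) := by
      simp [proxMultiplier, apply_add_offset]
    rw [e3] at e1
    have g1 := g t
    have g2 : θ / 2 * ‖P.A t (x (k + 1) t - x (k + 2) t)‖ ^ 2
        ≤ (ρ + τx) / 2 * ‖P.A t (x (k + 1) t - x (k + 2) t)‖ ^ 2 := by
      gcongr
      linarith
    have g3 : 0 ≤ σ * ‖x (k + 1) t - x (k + 2) t‖ ^ 2 := by positivity
    simp only [stepMultiplier] at g1
    linarith
  have key := lyapunov_decrease (z := z (k + 1)) (z' := z (k + 2)) (l := lam (k + 1))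
    (l' := lam (k + 2)) (g := P.couple (x (k + 1)) + z (k + 1) - P.b)
    (g' := P.couple (x (k + 2)) + z (k + 2) - P.b) (d := deltaZ θ τz z lam (k + 1))
    (v := fun t => P.A t (x (k + 2) t - x (k + 1) t)) hρ hθ hτz hτx hτρ
    (by
      change _ = _ + P.couple (x (k + 2) - x (k + 1)) + _
      rw [couple_sub]
      abel)
    (h.lam_update (k + 1)) (h.deltaZ_relation hτz hρ hθ (k + 1))
    (h.deltaZ_relation hτz hρ hθ (k + 2)) hv
  have p : 0 ≤ ∑ t, τx / 4 * ‖P.A t (x (k + 1) t - x k t)‖ ^ 2 :=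
    Finset.sum_nonneg fun _ _ => by positivity
  simp only [deltaZ] at key
  simp only [lyapunov, augLagrangian]
  linarith

end IsIterates

/-! ### Limit of the Lyapunov function, and the dual residual. -/

theorem Standing.continuous_cost (hP : P.Standing) : Continuous P.cost :=
  continuous_finsetSum _ fun t _ => (hP.smooth_f t).continuous.comp (continuous_apply t)

theorem Standing.minCost_le (hP : P.Standing) {x : Blocks n} (hx : ∀ t, x t ∈ P.X t) :
    P.minCost ≤ P.cost x := by
  have hc : IsCompact {x : Blocks n | ∀ t, x t ∈ P.X t} := by
    have := isCompact_univ_pi fun t => (hP.nonempty_compact t).2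
    simpa [Set.pi] using this
  exact csInf_le (hc.image hP.continuous_cost).bddBelow ⟨x, hx, rfl⟩

theorem Standing.tendsto_lyapunov (hP : P.Standing) {ρ θ τx τz : ℝ} {x : ℕ → Blocks n}
    {z lam : ℕ → Euc m} {xs : Blocks n} {zs lams : Euc m} (hfeas : P.couple xs + zs = P.b)
    (hx : Tendsto x atTop (𝓝 xs)) (hz : Tendsto z atTop (𝓝 zs)) (hl : Tendsto lam atTop (𝓝 lams)) :
    Tendsto (fun k => P.lyapunov ρ θ τx τz (x (k + 1)) (z (k + 1)) (lam (k + 1)) (x k) (z k)) atTop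
      (𝓝 (P.cost xs + θ / 2 * ‖zs‖ ^ 2)) := by
  have hcost := hP.continuous_cost
  have hcouple : Continuous P.couple := by
    rw [show P.couple = P.coupleL from funext fun y => (P.coupleL_apply y).symm]
    exact P.coupleL.continuous
  have hcont : Continuous fun p : Blocks n × Euc m × Euc m × Blocks n × Euc m =>
      P.lyapunov ρ θ τx τz p.1 p.2.1 p.2.2.1 p.2.2.2.1 p.2.2.2.2 := by
    unfold lyapunov augLagrangian
    fun_prop
  have hs : ∀ {α : Type} {u : ℕ → α} {l : Filter α}, Tendsto u atTop l →
      Tendsto (fun k => u (k + 1)) atTop l := fun hu => hu.comp (tendsto_add_atTop_nat 1)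
  have := (hcont.tendsto (xs, zs, lams, xs, zs)).comp ((hs hx).prodMk_nhds
    ((hs hz).prodMk_nhds ((hs hl).prodMk_nhds (hx.prodMk_nhds hz))))
  have e : P.lyapunov ρ θ τx τz xs zs lams xs zs = P.cost xs + θ / 2 * ‖zs‖ ^ 2 := by
    simp [lyapunov, augLagrangian, hfeas]
  rw [← e]
  exact this

/-- A gradient of the constraints is a normal, so the dual residual vanishes at a stationary
point. -/
theorem IsRegularPenaltySolution.dualResidual_eq_zero {θ : ℝ} {xs : Blocks n} {zs : Euc m}
    {mus : Blocks r} {lams : Euc m} (h : P.IsRegularPenaltySolution θ xs zs mus lams)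
    (hP : P.Standing) (t : Fin T) : P.dualResidual t (xs t) lams = 0 := by
  refine Metric.infDist_zero_of_mem ?_
  set v := -(gradient (P.f t) (xs t) + ContinuousLinearMap.adjoint (P.A t) lams) with hv
  have hv' : v = ContinuousLinearMap.adjoint (fderiv ℝ (P.c t) (xs t)) (mus t) := by
    rw [hv, neg_eq_iff_add_eq_zero, ← h.stationary_x t]
    abel
  have hxs : xs t ∈ P.X t := h.local_solution.1.1 t
  refine ⟨fun _ => xs t, fun _ => v, fun _ => hxs, tendsto_const_nhds, fun _ => ⟨hxs, ?_⟩,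
    tendsto_const_nhds⟩
  intro e he
  have hd := ((hP.smooth_c t).differentiable (by simp) (xs t)).hasFDerivAt.isLittleO.def
    (c := e / (‖mus t‖ + 1)) (by positivity)
  filter_upwards [nhdsWithin_le_nhds hd, self_mem_nhdsWithin] with y hy hyX
  have hcx : P.c t (xs t) = 0 := hxs
  have hcy : P.c t y = 0 := hyX
  rw [hcx, hcy, sub_zero, zero_sub, norm_neg] at hy
  rw [hv', ContinuousLinearMap.adjoint_inner_left]
  calc _ ≤ ‖mus t‖ * ‖fderiv ℝ (P.c t) (xs t) (y - xs t)‖ := real_inner_le_norm _ _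
    _ ≤ (‖mus t‖ + 1) * (e / (‖mus t‖ + 1) * ‖y - xs t‖) := by
        gcongr
        linarith
    _ = e * ‖y - xs t‖ := by field_simp

end BlockNLP

/-! ### Assembly of the local convergence theorem. -/

theorem theorem2 {T m : ℕ} {n r : Fin T → ℕ} (P : BlockNLP T m n r) (hP : P.Standing)
    (ε θ : ℝ) (hε0 : 0 < ε) (hε1 : ε < 1) (hθ : θ = 1 / ε ^ 2)
    (xs : Blocks n) (zs : Euc m) (mus : Blocks r) (lams : Euc m)
    (hsol : P.IsRegularPenaltySolution θ xs zs mus lams) :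
    ∃ ρbar : ℝ, 0 < ρbar ∧
      ∀ ρ τx τz : ℝ, ρbar < ρ → 0 < τx → 0 < τz →
        0 < τx / 4 - ((T : ℝ) - 1) * ρ / 2 →
        0 < τz / 4 - 2 * (θ + τz) ^ 2 / ρ →
        ∃ ε' C : ℝ, 0 < ε' ∧ 0 < C ∧
          ∀ (x : ℕ → Blocks n) (z lam : ℕ → Euc m),
            P.IsIterates ρ θ τx τz x z lam →
            P.SubproblemLICQ x →
            P.ClosestSelection ρ τx xs x z lam →
            P.scaledNorm (x 0 - xs) (z 0 - zs) (lam 0 - lams) < ε' →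
            lam 0 = -(θ • z 0) →
            -- convergence of the iterates
            (Tendsto x atTop (𝓝 xs) ∧ Tendsto z atTop (𝓝 zs) ∧ Tendsto lam atTop (𝓝 lams)) ∧
            -- sublinear rate
            (QSublinear (fun k => P.rateNorm ρ τx τz (x k - xs) (z k - zs) (lam k - lams)
                (deltaZ θ τz z lam k)) ∧
              ∀ k, blockNorm (x (k + 1) - xs) ≤
                C * P.rateNorm ρ τx τz (x k - xs) (z k - zs) (lam k - lams)
                  (deltaZ θ τz z lam k)) ∧
            -- the limit is an approximate KKT point of the original problem
            ((∀ t, xs t ∈ P.X t) ∧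
              P.primalResidual xs ≤ ε * Real.sqrt
                (2 * (P.lyapunov ρ θ τx τz (x 1) (z 1) (lam 1) (x 0) (z 0) - P.minCost)) ∧
              ∀ t, P.dualResidual t (xs t) lams ≤ ε * Real.sqrt
                (2 * (P.lyapunov ρ θ τx τz (x 1) (z 1) (lam 1) (x 0) (z 0) - P.minCost))) ∧
            -- second-order sufficient condition for the original problem
            ∀ w : Blocks n, P.jacobian xs w = 0 → w ≠ 0 →
              0 < hessianForm (fun y => P.lagrangian y mus lams) xs w := by
  have hθ0 : 0 < θ := by rw [hθ]; positivity
  have hfeas : P.couple xs + zs = P.b := hsol.local_solution.1.2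
  have hxs : ∀ t, xs t ∈ P.X t := hsol.local_solution.1.1
  obtain ⟨σ, hσ, R, hR, η, hη, hg⟩ := hsol.exists_growth hP
  obtain ⟨B, hB0, hB⟩ := P.exists_norm_couple_sq_le
  -- Two demands on `ρ`: the subproblem must dominate the `θ/2` term of the growth inequality, and
  -- the error `4θ²/ρ ‖A(x - x*)‖²` must stay below `σ‖x - x*‖²`.
  refine ⟨θ + 4 * θ ^ 2 * B / σ, by positivity, ?_⟩
  intro ρ τx τz hρbar hτx hτz hτxρ hτzρ
  have hfrac : 0 ≤ 4 * θ ^ 2 * B / σ := by positivity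
  have hρθ : θ ≤ ρ := by linarith
  have hρ : 0 < ρ := hθ0.trans_le hρθ
  have hρB : 4 * θ ^ 2 * B ≤ σ * ρ := by
    have : 4 * θ ^ 2 * B / σ ≤ ρ := by linarith
    rw [div_le_iff₀ hσ] at this
    linarith
  have hτ : 0 < τx - ((T : ℝ) - 1) * ρ := by linarith
  obtain ⟨s, hs, hstep⟩ := hsol.exists_localization hP hσ hR hη hρ hρθ hτx (by
    intro t y hy hyR
    have := (hg xs (Function.update xs t y) mus (fun _ => lams)
      (fun t => ⟨by simpa using hR, hxs t⟩) (fun u => by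
        by_cases hu : u = t
        · subst hu
          simpa using ⟨hyR, hy⟩
        · simpa [hu] using ⟨hR, hxs u⟩)
      (fun t => ⟨by simpa using hη, hsol.isKKTPoint t⟩)).1 t
    simpa using this)
  obtain ⟨e, he, ε', hε', hsmall, hstart⟩ := P.exists_energy_bounds hρ hτx hτz hτ hs
  refine ⟨ε', 1 / Real.sqrt (3 * σ), hε', by positivity, ?_⟩
  intro x z lam hit hlicq hsel h0 hlam0
  set E : ℕ → ℝ := fun k => P.energy ρ τx τz (x k - xs) (z k - zs) (lam k - lams)
    (deltaZ θ τz z lam k) with hE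
  have hE0 : ∀ k, 0 ≤ E k := fun k => BlockNLP.energy_nonneg hρ hτz hτ _ _ _ _
  choose mu hmu using fun k => hit.exists_multiplier hP hlicq k
  have hlocE : ∀ k, E k ≤ e → ∀ t, ‖x (k + 1) t - xs t‖ < R ∧
      ‖P.stepMultiplier ρ τx (x k) (z k) (lam k) t (x (k + 1) t) - lams‖ < η := fun k hk => by
    obtain ⟨h1, h2, h3⟩ := hsmall _ _ _ _ hk
    exact hstep (x k) (x (k + 1)) (z k) (lam k) h1 h2 h3 (hsel k)
  have hdecE : ∀ k, E k ≤ e → E (k + 1) + 3 * σ * blockNorm (x (k + 1) - xs) ^ 2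
      + 2 * θ * ‖deltaZ θ τz z lam (k + 1)‖ ^ 2 ≤ E k := fun k hk =>
    hit.energy_step hsol hR hη hg hB hρ hθ0 hτz hτ hρB (hlocE k hk) (hmu k)
  -- This closes the circle: energy at most `e` localizes the next step, and a localized step does
  -- not raise the energy.
  have hEe : ∀ k, E k ≤ e := by
    intro k
    induction k with
    | zero =>
      have hd : deltaZ θ τz z lam 0 = 0 := by simp [deltaZ, hlam0]
      simp only [hE, hd]
      exact hstart _ _ _ h0
    | succ k ih =>
      have h1 := hdecE k ih
      have h2 : 0 ≤ 3 * σ * blockNorm (x (k + 1) - xs) ^ 2 := by positivity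
      have h3 : 0 ≤ 2 * θ * ‖deltaZ θ τz z lam (k + 1)‖ ^ 2 := by positivity
      linarith
  have hloc := fun k => hlocE k (hEe k)
  have hdec := fun k => hdecE k (hEe k)
  have hxb : ∀ k, 3 * σ * blockNorm (x (k + 1) - xs) ^ 2 ≤ E k := fun k => by
    have h3 : 0 ≤ 2 * θ * ‖deltaZ θ τz z lam (k + 1)‖ ^ 2 := by positivity
    linarith [hdec k, hE0 (k + 1)]
  have hmono : ∀ k, E (k + 1) ≤ E k := fun k => by
    have h2 : 0 ≤ 3 * σ * blockNorm (x (k + 1) - xs) ^ 2 := by positivity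
    have h3 : 0 ≤ 2 * θ * ‖deltaZ θ τz z lam (k + 1)‖ ^ 2 := by positivity
    linarith [hdec k]
  have hnorm0 : ∀ {E' : Type} [NormedAddCommGroup E'] {u : ℕ → E'},
      Tendsto (fun k => ‖u (k + 1)‖ ^ 2) atTop (𝓝 0) → Tendsto u atTop (𝓝 0) := by
    intro E' _ u hu
    rw [← tendsto_add_atTop_iff_nat 1, tendsto_zero_iff_norm_tendsto_zero]
    simpa [Real.sqrt_sq] using hu.sqrt
  have hxS : Tendsto (fun k => blockNorm (x (k + 1) - xs) ^ 2) atTop (𝓝 0) :=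
    tendsto_zero_of_sufficient_decrease (c := 3 * σ) (by positivity) hE0
      (fun k => sq_nonneg _) fun k => by
        have h3 : 0 ≤ 2 * θ * ‖deltaZ θ τz z lam (k + 1)‖ ^ 2 := by positivity
        linarith [hdec k]
  have hd0 : Tendsto (deltaZ θ τz z lam) atTop (𝓝 0) :=
    hnorm0 (tendsto_zero_of_sufficient_decrease (c := 2 * θ) (by positivity) hE0
      (fun k => sq_nonneg _) fun k => by
        have h2 : 0 ≤ 3 * σ * blockNorm (x (k + 1) - xs) ^ 2 := by positivity
        linarith [hdec k])
  have hx0 : Tendsto (fun k => x k - xs) atTop (𝓝 0) := by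
    refine tendsto_pi_nhds.2 fun t => hnorm0 ?_
    refine squeeze_zero (fun k => sq_nonneg _) (fun k => ?_) hxS
    rw [blockNorm_sq]
    exact Finset.single_le_sum (f := fun t => ‖(x (k + 1) - xs) t‖ ^ 2)
      (fun _ _ => sq_nonneg _) (Finset.mem_univ t)
  have hx : Tendsto x atTop (𝓝 xs) := by simpa using hx0.add_const xs
  have hrel := fun k => hit.deltaZ_relation hτz hρ hθ0 k
  have hz0 : Tendsto (fun k => z k - zs) atTop (𝓝 0) := by
    rw [← tendsto_add_atTop_iff_nat 1]
    -- The coupling residual is a combination of increments of `z`, which vanish in the limit, so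
    -- `z` follows from the convergence of `x`.
    have hform : ∀ k, z (k + 1) - zs = ρ⁻¹ • (τz • deltaZ θ τz z lam k
        - (τz + θ) • deltaZ θ τz z lam (k + 1)) - P.coupleL (x (k + 1) - xs) := by
      intro k
      have h1 : ρ • (P.couple (x (k + 1)) + z (k + 1) - P.b) = τz • deltaZ θ τz z lam k
          - (τz + θ) • deltaZ θ τz z lam (k + 1) := by
        have h2 : ρ • (P.couple (x (k + 1)) + z (k + 1) - P.b) = lam (k + 1) - lam k := by
          rw [hit.lam_update k]; abel
        have h3 : lam (k + 1) = -(τz • deltaZ θ τz z lam (k + 1) + θ • z (k + 1)) := by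
          rw [eq_neg_iff_add_eq_zero, add_comm]; exact hrel (k + 1)
        have h4 : lam k = -(τz • deltaZ θ τz z lam k + θ • z k) := by
          rw [eq_neg_iff_add_eq_zero, add_comm]; exact hrel k
        rw [h2, h3, h4]
        have h5 : z k = z (k + 1) - deltaZ θ τz z lam (k + 1) := by simp [deltaZ]
        rw [h5]
        module
      rw [← h1, smul_smul, inv_mul_cancel₀ hρ.ne', one_smul, BlockNLP.coupleL_apply,
        BlockNLP.couple_sub, ← hfeas]
      abel
    simp only [hform]
    have hd1 := hd0.comp (tendsto_add_atTop_nat 1)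
    have hx1 := (P.coupleL.continuous.tendsto 0).comp (hx0.comp (tendsto_add_atTop_nat 1))
    have := (((hd0.const_smul τz).sub (hd1.const_smul (τz + θ))).const_smul ρ⁻¹).sub hx1
    simpa using this
  have hz : Tendsto z atTop (𝓝 zs) := by simpa using hz0.add_const zs
  have hl0 : Tendsto (fun k => lam k - lams) atTop (𝓝 0) := by
    have hform : ∀ k, lam k - lams = -(τz • deltaZ θ τz z lam k + θ • (z k - zs)) := by
      intro k
      rw [eq_neg_iff_add_eq_zero]
      have h1 : lam k - lams + (τz • deltaZ θ τz z lam k + θ • (z k - zs))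
        = (τz • deltaZ θ τz z lam k + θ • z k + lam k) - (θ • zs + lams) := by module
      rw [h1, hrel k, hsol.stationary_z, sub_zero]
    simp only [hform]
    simpa using ((hd0.const_smul τz).add (hz0.const_smul θ)).neg
  have hl : Tendsto lam atTop (𝓝 lams) := by simpa using hl0.add_const lams
  have hEl : Tendsto E atTop (𝓝 0) := by
    have hcont : Continuous fun p : Blocks n × Euc m × Euc m × Euc m =>
        P.energy ρ τx τz p.1 p.2.1 p.2.2.1 p.2.2.2 := by
      simp only [BlockNLP.energy, ← BlockNLP.coupleL_apply]
      fun_prop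
    have h1 := (hcont.tendsto (0, 0, 0, 0)).comp
      (hx0.prodMk_nhds (hz0.prodMk_nhds (hl0.prodMk_nhds hd0)))
    have h2 : P.energy ρ τx τz 0 0 0 0 = 0 := by
      simp [BlockNLP.energy, BlockNLP.couple]
    simp only [h2] at h1
    exact h1
  -- An antitone sequence lies above its limit; index `0` of the shifted sequence is `Φ^1`.
  have hΦ : P.cost xs + θ / 2 * ‖zs‖ ^ 2
      ≤ P.lyapunov ρ θ τx τz (x 1) (z 1) (lam 1) (x 0) (z 0) := by
    refine Antitone.le_of_tendsto (f := fun k => P.lyapunov ρ θ τx τz (x (k + 1)) (z (k + 1))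
      (lam (k + 1)) (x k) (z k)) (antitone_nat_of_succ_le fun k => ?_)
      (hP.tendsto_lyapunov hfeas hx hz hl) 0
    exact hit.lyapunov_step hg hσ hρ hθ0 hτz hρθ hτx hτxρ hτzρ (fun t => (hloc k t).1)
      (hloc (k + 1)) (hmu (k + 1))
  refine ⟨⟨hx, hz, hl⟩, ⟨⟨?_, fun k => Real.sqrt_nonneg _, fun k => ?_⟩, fun k => ?_⟩,
    ⟨hxs, ?_, fun t => ?_⟩, ?_⟩
  · simpa [BlockNLP.rateNorm_eq_sqrt_energy] using hEl.sqrt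
  · exact Real.sqrt_le_sqrt (hmono k)
  · rw [BlockNLP.rateNorm_eq_sqrt_energy, one_div_mul_eq_div, le_div_iff₀ (by positivity)]
    refine Real.le_sqrt_of_sq_le ?_
    rw [mul_pow, Real.sq_sqrt (by positivity), mul_comm]
    exact hxb k
  · have h1 : P.couple xs - P.b = -zs := by rw [← hfeas]; abel
    rw [BlockNLP.primalResidual, h1, norm_neg]
    have h2 := hP.minCost_le hxs
    have h3 : ‖zs‖ ^ 2 / ε ^ 2 ≤ 2 * (P.lyapunov ρ θ τx τz (x 1) (z 1) (lam 1) (x 0) (z 0)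
        - P.minCost) := by
      have : ‖zs‖ ^ 2 / ε ^ 2 = θ * ‖zs‖ ^ 2 := by rw [hθ]; ring
      linarith
    have h4 : ‖zs‖ / ε ≤ Real.sqrt (2 * (P.lyapunov ρ θ τx τz (x 1) (z 1) (lam 1) (x 0) (z 0)
        - P.minCost)) := Real.le_sqrt_of_sq_le (by rw [div_pow]; exact h3)
    rw [div_le_iff₀ hε0] at h4
    linarith
  · rw [hsol.dualResidual_eq_zero hP t]
    positivity
  · intro w hw hw0
    have h1 : ∀ t, fderiv ℝ (P.c t) (xs t) (w t) = 0 := fun t =>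
      congrFun (congrArg Prod.fst hw) t
    have h2 : P.couple w = 0 := congrArg Prod.snd hw
    have h3 := hsol.second_order w 0 h1 (by simpa using h2) (by simpa using blockNorm_pos hw0)
    rw [BlockNLP.hessianForm_penaltyLagrangian] at h3
    simpa using h3
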